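/- **Theorem (generalized adjoint method on Lie groups).** Let $G$ be a finite-dimensional real Lie group with identity $e$, Lie algebra $\mathfrak g=T_eG$ (with the bracket of left-invariant vector fields), dual $\mathfrak g^*$ and left translations $L_g$, and let $\mathcal P$ be a finite-dimensional smooth manifold of parameters. For $A,B\in\mathfrak g$ and $\bar P\in\mathfrak g^*$ write $\mathrm{ad}_AB=[A,B]$ and $(\mathrm{ad}^*_A\bar P)(B)=\bar P(\mathrm{ad}_AB)$. For $V:G\to\mathbb R$ differentiable at $g$ write $\bar{\mathrm d}_gV=(L_g)^*\mathrm dV(g)\in\mathfrak g^*$. Let $f_\theta(g,t)\in T_gG$ be a time- and parameter-dependent vector field on $G$ and $r(g,\theta,t)\in\mathbb R$ a running cost, both $C^1$ jointly in $(g,\theta,t)\in G\times\mathcal P\times\mathbb R$, and let $F:G\times\mathcal P\to\mathbb R$ be differentiable. Let $T\ge 0$ and $g_0\in G$, and suppose that for every $\theta\in\mathcal P$ the initial value problem $\dot g=f_\theta(g,t)$, $g(0)=g_0$, has a solution $g_\theta$ on $[0,T]$. Define the cost $$C(\theta)=F(g_\theta(T),\theta)+\int_0^T r(g_\theta(s),\theta,s)\,\mathrm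 ds ,$$ and, with $\tilde f_\theta(g,t)=(L_{g^{-1}})_*f_\theta(g,t)\in\mathfrak g$, the control Hamiltonian $$\mathcal H_c:G\times\mathfrak g^*\times\mathcal P\times\mathbb R\to\mathbb R,\qquad \mathcal H_c(g,\bar\lambda,\theta,t)=\bar\lambda\big(\tilde f_\theta(g,t)\big)+r(g,\theta,t).$$ Then for every $\theta\in\mathcal P$, with $g=g_\theta$: 1. There is exactly one curve $\bar\lambda:[0,T]\to\mathfrak g^*$ (the adjoint state) such that on $[0,T]$ $$\dot{\bar\lambda}=-\bar{\mathrm d}_g\big(\bar\lambda(\tilde f_\theta)+r\big)+\mathrm{ad}^*_{\tilde f_\theta}\bar\lambda,\qquad \bar\lambda(T)=\bar{\mathrm d}_{g(T)}F(\cdot,\theta),$$ where the right-hand side is taken at $(g(t),t)$ and $\bar\lambda=\bar\lambda(t)$ is held fixed in the gradient. 2. The pair $(g,\bar\lambda)$ satisfies Hamilton's equations of $\mathcal H_c$ in the left trivialization $T^*G\cong G\times\mathfrak g^*$, $$\dot g=(L_g)_*\big(\mathrm d_{\bar\lambda}\mathcal H_c\big),\qquad \dot{\bar\lambda}=-\bar{\mathrm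 d}_g\mathcal H_c+\mathrm{ad}^*_{\mathrm d_{\bar\lambda}\mathcal H_c}\bar\lambda,$$ where $\mathrm d_{\bar\lambda}\mathcal H_c\in(\mathfrak g^*)^*=\mathfrak g$. 3. $C$ is differentiable at $\theta$, the curve $t\mapsto \mathrm d_\theta\mathcal H_c(g(t),\bar\lambda(t),\theta,t)\in T^*_\theta\mathcal P$ is integrable on $[0,T]$, and $$\mathrm d_\theta C=\mathrm d_\theta F(g(T),\theta)+\int_0^T \mathrm d_\theta\mathcal H_c\big(g(t),\bar\lambda(t),\theta,t\big)\,\mathrm dt ,$$ where on the right-hand side $\mathrm d_\theta$ is the partial differential with $g(T)$, respectively $(g(t),\bar\lambda(t),t)$, held fixed. -/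

import Mathlib

open Set
open scoped Manifold ContDiff

noncomputable section

namespace LieAdjoint

section LieGroupNotions

variable {E : Type*} [NormedAddCommGroup E] [NormedSpace ℝ E]
  {G : Type*} [TopologicalSpace G] [ChartedSpace E G] [Group G]

/-- A real Lie group of class `C^∞` meets the smoothness requirement of Mathlib's Lie bracket. -/
instance lieGroupMinSmoothness [LieGroup 𝓘(ℝ, E) ∞ G] :
    LieGroup 𝓘(ℝ, E) (minSmoothness ℝ 3) G := by
  rw [minSmoothness_of_isRCLikeNormedField]
  infer_instance

variable (E G) in
/-- The Lie algebra `𝔤 = T_e G`. -/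
abbrev LieAlg : Type _ := GroupLieAlgebra 𝓘(ℝ, E) G

variable (E G) in
/-- The dual `𝔤* = T_e* G` of the Lie algebra. -/
abbrev LieDual : Type _ := LieAlg E G →L[ℝ] ℝ

/-- The left translation `(L_{g⁻¹})_* v ∈ 𝔤` of a tangent vector `v ∈ T_g G`. (The target of the
derivative is the tangent space at `g⁻¹ * g`, which is the identity.) -/
def leftTrivialize (g : G) (v : TangentSpace 𝓘(ℝ, E) g) : LieAlg E G :=
  mfderiv 𝓘(ℝ, E) 𝓘(ℝ, E) (fun h : G => g⁻¹ * h) g v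

/-- The left-trivialized gradient `d̄_g V = (L_g)^* dV(g) ∈ 𝔤*`. (The derivative of `L_g` at the
identity takes values in the tangent space at `g * 1 = g`.) -/
def leftGrad (V : G → ℝ) (g : G) : LieDual E G :=
  (show TangentSpace 𝓘(ℝ, E) g →L[ℝ] ℝ from mfderiv 𝓘(ℝ, E) 𝓘(ℝ, ℝ) V g).comp
    (show LieAlg E G →L[ℝ] TangentSpace 𝓘(ℝ, E) g from
      mfderiv 𝓘(ℝ, E) 𝓘(ℝ, E) (fun h : G => g * h) 1)

/-- The adjoint map `ad_A B = ⁅A, B⁆` on `𝔤`, for the bracket of left-invariant vector fields. -/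
def lieAd [FiniteDimensional ℝ E] [LieGroup 𝓘(ℝ, E) ∞ G] (A : LieAlg E G) :
    LieAlg E G →L[ℝ] LieAlg E G :=
  haveI : CompleteSpace E := FiniteDimensional.complete ℝ E
  { toFun := fun B => ⁅A, B⁆
    map_add' := fun B C => lie_add A B C
    map_smul' := fun c B => lie_smul c A B
    cont := by
      let L : E →ₗ[ℝ] E :=
        { toFun := fun B => (⁅A, (show LieAlg E G from B)⁆ : LieAlg E G)
          map_add' := fun B C => lie_add A (show LieAlg E G from B) (show LieAlg E G from C)
          map_smul' := fun c B => lie_smul c A (show LieAlg E G from B) }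
      exact L.continuous_of_finiteDimensional }

/-- The dual `ad*_A : 𝔤* → 𝔤*` of the adjoint map, `(ad*_A P)(B) = P (ad_A B)`. -/
def lieAdDual [FiniteDimensional ℝ E] [LieGroup 𝓘(ℝ, E) ∞ G] (A : LieAlg E G)
    (P : LieDual E G) : LieDual E G :=
  P.comp (lieAd A)

/-- Evaluation `P ↦ P ξ`, the element of `(𝔤*)*` that corresponds to `ξ ∈ 𝔤`. -/
def dualEval (ξ : LieAlg E G) : LieDual E G →L[ℝ] ℝ :=
  (ContinuousLinearMap.apply ℝ ℝ (show E from ξ) : (E →L[ℝ] ℝ) →L[ℝ] ℝ)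

/-- `(g, P)` solves, on the set `s` of times, Hamilton's equations of the time-dependent Hamiltonian
`H` on `G × 𝔤*` (the left trivialization of `T*G`):
`ġ = (L_g)_* (d_P H)` and `Ṗ = - d̄_g H + ad*_{d_P H} P`.
Here `ξ = d_P H` is viewed as an element of `𝔤` through `(𝔤*)* = 𝔤`. -/
def SolvesLieHamilton [FiniteDimensional ℝ E] [LieGroup 𝓘(ℝ, E) ∞ G]
    (H : ℝ → G → LieDual E G → ℝ) (g : ℝ → G) (P : ℝ → LieDual E G) (s : Set ℝ) : Prop :=
  ∀ t ∈ s, ∃ ξ : LieAlg E G,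
    HasFDerivAt (fun Q : LieDual E G => H t (g t) Q)
      (dualEval ξ) (P t) ∧
    HasMFDerivWithinAt 𝓘(ℝ, ℝ) 𝓘(ℝ, E) g s t
      ((1 : ℝ →L[ℝ] ℝ).smulRight (mulInvariantVectorField ξ (g t))) ∧
    HasDerivWithinAt P (- leftGrad (fun h : G => H t h (P t)) (g t) + lieAdDual ξ (P t)) s t

end LieGroupNotions

section Control

variable {E : Type*} [NormedAddCommGroup E] [NormedSpace ℝ E]
  {G : Type*} [TopologicalSpace G] [ChartedSpace E G] [Group G]
  {Θ : Type*}

/-- `g` solves the initial value problem `ġ = v(g, t)`, `g(0) = g₀` on `[0, T]`. -/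
def SolvesIVP (v : (h : G) → ℝ → TangentSpace 𝓘(ℝ, E) h) (T : ℝ) (g₀ : G) (g : ℝ → G) : Prop :=
  g 0 = g₀ ∧ ∀ t ∈ Icc 0 T, HasMFDerivWithinAt 𝓘(ℝ, ℝ) 𝓘(ℝ, E) g (Icc 0 T) t
    ((1 : ℝ →L[ℝ] ℝ).smulRight (v (g t) t))

/-- The control Hamiltonian `𝓗_c(g, P, θ, t) = P (f̃_θ(g, t)) + r(g, θ, t)`. -/
def controlHamiltonian (f : Θ → (h : G) → ℝ → TangentSpace 𝓘(ℝ, E) h) (r : G → Θ → ℝ → ℝ)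
    (g : G) (P : LieDual E G) (θ : Θ) (t : ℝ) : ℝ :=
  P (leftTrivialize g (f θ g t)) + r g θ t

/-- The cost `F(g_θ(T), θ) + ∫₀ᵀ r(g_θ(s), θ, s) ds` along the family of trajectories `g_θ`. -/
def trajectoryCost (r : G → Θ → ℝ → ℝ) (F : G → Θ → ℝ) (T : ℝ) (g : Θ → ℝ → G) (θ : Θ) : ℝ :=
  F (g θ T) θ + ∫ s in (0 : ℝ)..T, r (g θ s) θ s

/-- The differential `d_θ V ∈ T_θ* Θ` of a function of the parameter. (The tangent space at `θ` is
the model space `EΘ`, whose norm makes the integral of a curve in `T_θ* Θ` available.) -/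
def paramGrad (EΘ : Type*) [NormedAddCommGroup EΘ] [NormedSpace ℝ EΘ] {Θ : Type*}
    [TopologicalSpace Θ] [ChartedSpace EΘ Θ] (V : Θ → ℝ) (θ : Θ) : EΘ →L[ℝ] ℝ :=
  mfderiv 𝓘(ℝ, EΘ) 𝓘(ℝ, ℝ) V θ

/-- `P : [0, T] → 𝔤*` is an adjoint state along `g`:
`Ṗ = - d̄_g (P (f̃_θ) + r) + ad*_{f̃_θ} P` and `P(T) = d̄_g F`. -/
def IsAdjointState [FiniteDimensional ℝ E] [LieGroup 𝓘(ℝ, E) ∞ G]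
    (f : Θ → (h : G) → ℝ → TangentSpace 𝓘(ℝ, E) h) (r : G → Θ → ℝ → ℝ)
    (F : G → Θ → ℝ) (T : ℝ) (θ : Θ) (g : ℝ → G) (P : ℝ → LieDual E G) : Prop :=
  (∀ t ∈ Icc 0 T, HasDerivWithinAt P
    (- leftGrad (fun h : G => P t (leftTrivialize h (f θ h t)) + r h θ t) (g t)
      + lieAdDual (leftTrivialize (g t) (f θ (g t) t)) (P t)) (Icc 0 T) t) ∧
  P T = leftGrad (fun h : G => F h θ) (g T)

end Control

end LieAdjoint

end

/-!
Write `γ = g_θ`. A perturbed trajectory is compared with `γ` through its deviation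
`c_η(t) = γ(t)⁻¹ g_η(t)`, which starts at the identity and, for `η` near `θ`, stays near it; so a
single chart of `G`, the one at the identity, serves on all of `[0, T]`, and no chart along `γ`
has to be chosen. Let `y` be the coordinate of `c_η`. It satisfies
`y' = (L_y)_* f̃_η - (R_y)_* f̃_θ` (`hasDerivWithinAt_deviation`), an equation for which the
identity is stationary at `η = θ`. Linearizing `(L_y)_*` and `(R_y)_*` at the identity gives the first
derivatives of the coordinate expression of left-invariant vector fields, hence their bracket: the
linearization of the right-hand side in `y` is `D f̃_θ - ad_{f̃_θ}` (`lie_eq_fderiv_chartLeftMul`,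
`fderiv_chartRightMul_apply`, `fderiv_deviationField`). Its transpose, with the derivative of the
running cost, is the right-hand side of the adjoint equation (`adjoint_rhs_eq`). That equation is
linear in the adjoint state with continuous coefficients, so it has exactly one solution with the
prescribed terminal value (`exists_solution_linear`, `eqOn_of_solution_linear`).

For the cost, Grönwall's inequality shows that `y` stays within `C ‖η - θ‖` of the coordinate of
the identity; since this bound holds only while the deviation is in the chart, it is combined with
the fact that a curve cannot leave an open set without leaving a closed subset of it
(`exists_eventually_deviation_le`). Given the bound, the product rule for
`λ(t) y(t) + ∫₀ᵗ r` and the adjoint equation leave only the parameter derivatives and errors of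
first-order Taylor expansions, which are `o(‖η - θ‖)` uniformly on `[0, T]`
(`hasFDerivAt_cost_of_adjoint`). In particular no differentiability of the trajectories in the
parameter is used. The parameter derivative of the deviation equation at `y = 1` is the one of
`f̃_η`, so the integrand is the parameter differential of the control Hamiltonian
(`paramGrad_controlHamiltonian`).
-/

noncomputable section

namespace LieAdjoint

/-! ### Linear differential equations -/

section LinearODE

open Filter Topology MeasureTheory Metric
open scoped NNReal

variable {V : Type*} [NormedAddCommGroup V] [NormedSpace ℝ V]

/-- The radial retraction of a normed space onto the closed ball of radius `R` about `0`. -/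
def radialRetraction (R : ℝ) (x : V) : V := (R / max R ‖x‖) • x

lemma radialRetraction_eq_self {R : ℝ} (hR : 0 < R) {x : V} (hx : ‖x‖ ≤ R) :
    radialRetraction R x = x := by
  rw [radialRetraction, max_eq_left hx, div_self hR.ne', one_smul]

lemma norm_radialRetraction_le {R : ℝ} (hR : 0 < R) (x : V) : ‖radialRetraction R x‖ ≤ R := by
  have hm : 0 < max R ‖x‖ := lt_max_of_lt_left hR
  rw [radialRetraction, norm_smul, Real.norm_of_nonneg (by positivity), div_mul_eq_mul_div,
    div_le_iff₀ hm]
  gcongr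
  exact le_max_right _ _

lemma norm_radialRetraction_le_norm {R : ℝ} (hR : 0 < R) (x : V) :
    ‖radialRetraction R x‖ ≤ ‖x‖ := by
  have hm : 0 < max R ‖x‖ := lt_max_of_lt_left hR
  rw [radialRetraction, norm_smul, Real.norm_of_nonneg (by positivity)]
  refine mul_le_of_le_one_left (norm_nonneg _) ?_
  rw [div_le_one hm]
  exact le_max_left _ _

lemma lipschitzWith_radialRetraction {R : ℝ} (hR : 0 < R) :
    LipschitzWith 2 (radialRetraction R : V → V) := by
  refine LipschitzWith.of_dist_le_mul fun x y => ?_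
  rw [dist_eq_norm, dist_eq_norm]
  set a := max R ‖x‖ with ha
  set b := max R ‖y‖ with hb
  have ha0 : 0 < a := lt_max_of_lt_left hR
  have hb0 : 0 < b := lt_max_of_lt_left hR
  have hyb : ‖y‖ ≤ b := le_max_right _ _
  have hRa : R ≤ a := le_max_left _ _
  have hab : |b - a| ≤ ‖x - y‖ := by
    calc |b - a| ≤ |‖y‖ - ‖x‖| := by
          rw [hb, ha]
          refine (abs_max_sub_max_le_max R ‖y‖ R ‖x‖).trans ?_
          simp
      _ ≤ ‖y - x‖ := abs_norm_sub_norm_le y x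
      _ = ‖x - y‖ := norm_sub_rev _ _
  have h : radialRetraction R x - radialRetraction R y
      = (R / a) • (x - y) + ((R / a) * ((b - a) / b)) • y := by
    rw [radialRetraction, radialRetraction, ← ha, ← hb, smul_sub, sub_add_eq_add_sub, add_sub_assoc,
      sub_eq_add_neg, ← neg_smul, sub_eq_add_neg _ ((R / a) • y), ← neg_smul, ← add_smul]
    congr 2
    field_simp
    ring
  have hRa1 : R / a ≤ 1 := (div_le_one ha0).2 hRa
  rw [h]
  calc _ ≤ (R / a) * ‖x - y‖ + (R / a) * (|b - a| / b) * ‖y‖ := by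
        refine (norm_add_le _ _).trans (le_of_eq ?_)
        rw [norm_smul, norm_smul, norm_mul, norm_div, norm_div, Real.norm_of_nonneg hR.le,
          Real.norm_of_nonneg ha0.le, Real.norm_of_nonneg hb0.le, Real.norm_eq_abs]
    _ ≤ 1 * ‖x - y‖ + 1 * (|b - a| / b) * b := by gcongr
    _ = ‖x - y‖ + |b - a| := by field_simp
    _ ≤ (2 : ℝ≥0) * ‖x - y‖ := by
        rw [NNReal.coe_ofNat]; linarith

lemma hasDerivWithinAt_Ici_of_Icc {x : ℝ → V} {x' : V} {a b t : ℝ} (ht : t ∈ Ico a b)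
    (h : HasDerivWithinAt x x' (Icc a b) t) : HasDerivWithinAt x x' (Ici t) t :=
  h.mono_of_mem_nhdsWithin (Icc_mem_nhdsGE_of_mem ht)

lemma hasDerivWithinAt_Iic_of_Icc {x : ℝ → V} {x' : V} {a b t : ℝ} (ht : t ∈ Ioc a b)
    (h : HasDerivWithinAt x x' (Icc a b) t) : HasDerivWithinAt x x' (Iic t) t :=
  h.mono_of_mem_nhdsWithin (Icc_mem_nhdsLE_of_mem ht)

lemma exists_norm_bound {W : Type*} [NormedAddCommGroup W] {T : ℝ} {L : ℝ → W}
    (hL : ContinuousOn L (Icc 0 T)) : ∃ M, 0 ≤ M ∧ ∀ t ∈ Icc 0 T, ‖L t‖ ≤ M := by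
  obtain ⟨M, hM⟩ := isCompact_Icc.exists_bound_of_continuousOn hL
  exact ⟨max M 0, le_max_right _ _, fun t ht => (hM t ht).trans (le_max_left _ _)⟩

/-- Linear differential equations have solutions on the whole interval. The equation is truncated
by a radial retraction, so that Picard-Lindelöf applies on all of `[0, T]`; by Grönwall's
inequality the truncated solution never reaches the radius of truncation. -/
theorem exists_forward_solution_linear [CompleteSpace V] {T : ℝ} (hT : 0 ≤ T) {L : ℝ → V →L[ℝ] V}
    (hL : ContinuousOn L (Icc 0 T)) {b : ℝ → V} (hb : ContinuousOn b (Icc 0 T)) (x₀ : V) :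
    ∃ x : ℝ → V, x 0 = x₀ ∧
      ∀ t ∈ Icc 0 T, HasDerivWithinAt x (L t (x t) + b t) (Icc 0 T) t := by
  obtain ⟨M, hM0, hM⟩ := exists_norm_bound hL
  obtain ⟨β, hβ0, hβ⟩ := exists_norm_bound hb
  set R : ℝ := max (gronwallBound ‖x₀‖ M β T) 1 with hRdef
  have hR : 0 < R := lt_max_of_lt_right one_pos
  let f : ℝ → V → V := fun t x => L t (radialRetraction R x) + b t
  have hP : IsPicardLindelof f (tmin := 0) (tmax := T) ⟨0, left_mem_Icc.2 hT⟩ x₀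
      (((M * R + β) * T).toNNReal) 0 ((M * R + β).toNNReal) ((2 * M).toNNReal) := by
    refine ⟨fun t ht => ?_, fun x _ => ?_, fun t ht x _ => ?_, ?_⟩
    · refine (LipschitzWith.of_dist_le_mul fun x y => ?_).lipschitzOnWith
      rw [dist_eq_norm, Real.coe_toNNReal _ (by positivity)]
      have h2 := (lipschitzWith_radialRetraction (V := V) hR).dist_le_mul x y
      rw [dist_eq_norm, NNReal.coe_ofNat] at h2
      calc ‖f t x - f t y‖ = ‖L t (radialRetraction R x - radialRetraction R y)‖ := by
            simp [f]
        _ ≤ ‖L t‖ * ‖radialRetraction R x - radialRetraction R y‖ := (L t).le_opNorm _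
        _ ≤ M * (2 * dist x y) := by gcongr; exact hM t ht
        _ = 2 * M * dist x y := by ring
    · exact (hL.clm_apply continuousOn_const).add hb
    · rw [Real.coe_toNNReal _ (by positivity)]
      refine (norm_add_le _ _).trans (add_le_add (((L t).le_opNorm _).trans ?_) (hβ t ht))
      gcongr
      exacts [hM t ht, norm_radialRetraction_le hR x]
    · rw [Real.coe_toNNReal _ (by positivity), Real.coe_toNNReal _ (by positivity)]
      simp [hT]
  obtain ⟨x, hx0, hx⟩ := hP.exists_eq_forall_mem_Icc_hasDerivWithinAt₀
  have hbound : ∀ t ∈ Icc 0 T, ‖x t‖ ≤ R := by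
    intro t ht
    have := norm_le_gronwallBound_of_norm_deriv_right_le (f := x) (δ := ‖x₀‖) (K := M) (ε := β)
      (fun s hs => (hx s hs).continuousWithinAt)
      (fun s hs => hasDerivWithinAt_Ici_of_Icc hs (hx s (Ico_subset_Icc_self hs)))
      (by simp at hx0; simp [hx0])
      (fun s hs => by
        have hs' := Ico_subset_Icc_self hs
        refine (norm_add_le _ _).trans (add_le_add (((L s).le_opNorm _).trans ?_) (hβ s hs'))
        gcongr
        exacts [hM s hs', norm_radialRetraction_le_norm hR _]) t ht
    refine this.trans (le_trans ?_ (le_max_left _ _))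
    exact gronwallBound_mono (norm_nonneg _) hβ0 hM0 (by linarith [ht.2])
  refine ⟨x, hx0, fun t ht => ?_⟩
  have := hx t ht
  simp only [f] at this
  rwa [radialRetraction_eq_self hR (hbound t ht)] at this

/-- Linear differential equations can be solved on `[0, T]` with a prescribed terminal value. -/
theorem exists_solution_linear [CompleteSpace V] {T : ℝ} (hT : 0 ≤ T) {L : ℝ → V →L[ℝ] V}
    (hL : ContinuousOn L (Icc 0 T)) {b : ℝ → V} (hb : ContinuousOn b (Icc 0 T)) (x₁ : V) :
    ∃ x : ℝ → V, x T = x₁ ∧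
      ∀ t ∈ Icc 0 T, HasDerivWithinAt x (L t (x t) + b t) (Icc 0 T) t := by
  have hrev : MapsTo (fun t : ℝ => T - t) (Icc 0 T) (Icc 0 T) := fun t ht =>
    ⟨by linarith [ht.2], by linarith [ht.1]⟩
  have hrevc : ContinuousOn (fun t : ℝ => T - t) (Icc 0 T) := by fun_prop
  obtain ⟨x, hx0, hx⟩ := exists_forward_solution_linear hT (hL.comp hrevc hrev).neg
    (hb.comp hrevc hrev).neg x₁
  refine ⟨fun t => x (T - t), by simpa using hx0, fun t ht => ?_⟩
  have h := (hx (T - t) (hrev ht)).scomp t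
    ((hasDerivAt_id t).const_sub T).hasDerivWithinAt hrev
  convert h using 1
  · rfl
  · simp [add_comm]

/-- A solution of a linear differential equation on `[0, T]` is determined by its terminal value. -/
theorem eqOn_of_solution_linear {T : ℝ} {L : ℝ → V →L[ℝ] V}
    (hL : ContinuousOn L (Icc 0 T)) {b x y : ℝ → V}
    (hx : ∀ t ∈ Icc 0 T, HasDerivWithinAt x (L t (x t) + b t) (Icc 0 T) t)
    (hy : ∀ t ∈ Icc 0 T, HasDerivWithinAt y (L t (y t) + b t) (Icc 0 T) t)
    (h : x T = y T) : EqOn x y (Icc 0 T) := by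
  obtain ⟨M, hM0, hM⟩ := exists_norm_bound hL
  refine ODE_solution_unique_of_mem_Icc_left (v := fun t x => L t x + b t) (s := fun _ => univ)
    (K := M.toNNReal) (fun t ht => ?_)
    (fun t ht => (hx t ht).continuousWithinAt)
    (fun t ht => hasDerivWithinAt_Iic_of_Icc ht (hx t (Ioc_subset_Icc_self ht)))
    (fun _ _ => mem_univ _)
    (fun t ht => (hy t ht).continuousWithinAt)
    (fun t ht => hasDerivWithinAt_Iic_of_Icc ht (hy t (Ioc_subset_Icc_self ht)))
    (fun _ _ => mem_univ _) h
  refine (LipschitzWith.of_dist_le_mul fun x y => ?_).lipschitzOnWith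
  rw [dist_eq_norm, Real.coe_toNNReal _ hM0, dist_eq_norm, add_sub_add_right_eq_sub, ← map_sub]
  refine ((L t).le_opNorm _).trans ?_
  gcongr
  exact hM t (Ioc_subset_Icc_self ht)

end LinearODE

/-! ### Derivative of a cost by the adjoint method in a normed space -/

section FirstVariation

open Filter Topology MeasureTheory Metric Asymptotics

variable {X F : Type*} [NormedAddCommGroup X] [NormedSpace ℝ X] [NormedAddCommGroup F]
  [NormedSpace ℝ F]

/-- `D t` is the derivative of `V t` at `x₀`, uniformly in the parameter `t ∈ K`. -/
def IsUniformLinearization {ι : Type*} (K : Set ι) (V : ι → X → F) (x₀ : X) (D : ι → X →L[ℝ] F) :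
    Prop :=
  ∀ ε > 0, ∀ᶠ x in 𝓝 x₀, ∀ t ∈ K, ‖V t x - V t x₀ - D t (x - x₀)‖ ≤ ε * ‖x - x₀‖

/-- `D t` is the derivative of `V t` at `x₀`, locally uniformly in the parameter `t ∈ K`, even when
`D t₀` replaces `D t` for `t` near `t₀`. -/
def IsLocallyUniformLinearization {ι : Type*} [TopologicalSpace ι] (K : Set ι) (V : ι → X → F)
    (x₀ : X) (D : ι → X →L[ℝ] F) : Prop :=
  ∀ t₀ ∈ K, ∀ ε > 0, ∀ᶠ z : ι × X in 𝓝 (t₀, x₀), z.1 ∈ K →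
    ‖V z.1 z.2 - V z.1 x₀ - D t₀ (z.2 - x₀)‖ ≤ ε * ‖z.2 - x₀‖

namespace IsLocallyUniformLinearization

variable {ι : Type*} [TopologicalSpace ι] {K : Set ι} {V : ι → X → F} {x₀ : X} {D : ι → X →L[ℝ] F}

lemma eventually_norm_sub_le (h : IsLocallyUniformLinearization K V x₀ D) {t₀ : ι} (ht₀ : t₀ ∈ K)
    {ε : ℝ} (hε : 0 < ε) : ∀ᶠ t in 𝓝 t₀, t ∈ K → ‖D t - D t₀‖ ≤ ε := by
  have h1 := h t₀ ht₀ (ε / 2) (half_pos hε)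
  rw [nhds_prod_eq] at h1
  filter_upwards [h1.curry] with t ht htK
  have h2 := h t htK (ε / 2) (half_pos hε)
  rw [nhds_prod_eq] at h2
  have h3 := h2.curry.self_of_nhds
  refine ContinuousLinearMap.opNorm_le_of_nhds_zero hε.le ?_
  have h4 : Tendsto (fun y : X => x₀ + y) (𝓝 0) (𝓝 x₀) := by
    have : Continuous fun y : X => x₀ + y := by fun_prop
    simpa using this.tendsto 0
  filter_upwards [h4.eventually ht, h4.eventually h3] with y hy1 hy2
  have e1 := hy1 htK
  have e2 := hy2 htK
  simp only [add_sub_cancel_left] at e1 e2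
  calc ‖(D t - D t₀) y‖ = ‖(V t (x₀ + y) - V t x₀ - D t₀ y) - (V t (x₀ + y) - V t x₀ - D t y)‖ := by
        congr 1
        simp
    _ ≤ ε / 2 * ‖y‖ + ε / 2 * ‖y‖ := (norm_sub_le _ _).trans (add_le_add e1 e2)
    _ = ε * ‖y‖ := by ring

lemma continuousOn (h : IsLocallyUniformLinearization K V x₀ D) : ContinuousOn D K := by
  intro t₀ ht₀
  refine Metric.tendsto_nhds.2 fun ε hε => ?_
  filter_upwards [nhdsWithin_le_nhds (h.eventually_norm_sub_le ht₀ (half_pos hε)),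
    self_mem_nhdsWithin] with t ht htK
  rw [dist_eq_norm]
  exact (ht htK).trans_lt (half_lt_self hε)

lemma isUniformLinearization (h : IsLocallyUniformLinearization K V x₀ D) (hK : IsCompact K) :
    IsUniformLinearization K V x₀ D := by
  intro ε hε
  suffices H : ∀ᶠ x in 𝓝 x₀, ∀ t ∈ K, t ∈ K →
      ‖V t x - V t x₀ - D t (x - x₀)‖ ≤ ε * ‖x - x₀‖ from
    H.mono fun x hx t ht => hx t ht ht
  refine hK.eventually_forall_of_forall_eventually fun t₀ ht₀ => ?_
  have h1 := (continuous_swap.tendsto (x₀, t₀)).eventually (h t₀ ht₀ (ε / 2) (half_pos hε))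
  have h2 := (continuous_snd.tendsto (x₀, t₀)).eventually
    (h.eventually_norm_sub_le ht₀ (half_pos hε))
  filter_upwards [h1, h2] with ⟨x, t⟩ hz1 hz2 ht
  calc ‖V t x - V t x₀ - D t (x - x₀)‖
      = ‖(V t x - V t x₀ - D t₀ (x - x₀)) - (D t - D t₀) (x - x₀)‖ := by
        congr 1
        rw [sub_apply]
        abel
    _ ≤ ε / 2 * ‖x - x₀‖ + ε / 2 * ‖x - x₀‖ := by
        refine (norm_sub_le _ _).trans (add_le_add (hz1 ht) ?_)
        exact (ContinuousLinearMap.le_opNorm _ _).trans (by gcongr; exact hz2 ht)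
    _ = ε * ‖x - x₀‖ := by ring

end IsLocallyUniformLinearization

section Trajectories

variable {E Q : Type*} [NormedAddCommGroup E] [NormedSpace ℝ E] [NormedAddCommGroup Q]
  [NormedSpace ℝ Q]

/-- If the linearization of `v` at the stationary point `(y₀, p₀)` is uniform in time, then by
Grönwall's inequality the solutions of `z' = v t (z, p)` that start at `y₀` depend on `p` at most
linearly near `p₀`, as long as they stay near `y₀`. -/
lemma exists_norm_sub_le_of_stationary {T : ℝ} {v : ℝ → E × Q → E} {y₀ : E} {p₀ : Q}
    {D : ℝ → E × Q →L[ℝ] E} (hv : IsUniformLinearization (Icc 0 T) v (y₀, p₀) D)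
    (hD : ContinuousOn D (Icc 0 T)) (hv₀ : ∀ t ∈ Icc 0 T, v t (y₀, p₀) = 0) :
    ∃ δ > 0, ∃ C > 0, ∀ p, ‖p - p₀‖ < δ → ∀ τ ≤ T, ∀ z : ℝ → E, z 0 = y₀ →
      ContinuousOn z (Icc 0 τ) →
      (∀ t ∈ Ico 0 τ, ‖z t - y₀‖ < δ ∧ HasDerivWithinAt z (v t (z t, p)) (Ici t) t) →
      ∀ t ∈ Icc 0 τ, ‖z t - y₀‖ ≤ C * ‖p - p₀‖ := by
  obtain ⟨M, hM0, hM⟩ := exists_norm_bound hD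
  obtain ⟨δ, hδ, hball⟩ := Metric.eventually_nhds_iff.1 (hv 1 one_pos)
  refine ⟨δ, hδ, Real.exp ((M + 1) * T), Real.exp_pos _, ?_⟩
  intro p hp τ hτ z hz0 hzc hz t ht
  have hM1 : 0 < M + 1 := by positivity
  have hbound : ∀ s ∈ Ico 0 τ, ‖v s (z s, p)‖ ≤ (M + 1) * ‖z s - y₀‖ + (M + 1) * ‖p - p₀‖ := by
    intro s hs
    have hsT : s ∈ Icc 0 T := ⟨hs.1, hs.2.le.trans hτ⟩
    have h1 := hball (y := (z s, p)) (by
      rw [Prod.dist_eq, dist_eq_norm, dist_eq_norm]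
      exact max_lt (hz s hs).1 hp) s hsT
    rw [hv₀ s hsT, sub_zero, Prod.mk_sub_mk] at h1
    have h2 : ‖v s (z s, p)‖ ≤ (M + 1) * ‖(z s - y₀, p - p₀)‖ := by
      calc ‖v s (z s, p)‖
          = ‖(v s (z s, p) - D s (z s - y₀, p - p₀)) + D s (z s - y₀, p - p₀)‖ := by simp
        _ ≤ 1 * ‖(z s - y₀, p - p₀)‖ + M * ‖(z s - y₀, p - p₀)‖ := by
            refine (norm_add_le _ _).trans (add_le_add h1 (((D s).le_opNorm _).trans ?_))
            gcongr
            exact hM s hsT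
        _ = _ := by ring
    refine h2.trans ?_
    rw [← mul_add]
    gcongr
    exact max_le (by simp) (by simp)
  have h := norm_le_gronwallBound_of_norm_deriv_right_le (f := fun t => z t - y₀) (δ := 0)
    (hzc.sub continuousOn_const) (fun s hs => (hz s hs).2.sub_const y₀) (by simp [hz0]) hbound t ht
  refine h.trans ?_
  rw [gronwallBound_of_K_ne_0 hM1.ne']
  simp only [zero_mul, zero_add, sub_zero]
  rw [mul_div_cancel_left₀ _ hM1.ne', mul_comm]
  gcongr
  refine (sub_le_self _ zero_le_one).trans (Real.exp_le_exp.2 ?_)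
  gcongr
  exact ht.2.trans hτ

/-- The adjoint formula for the derivative of a cost along solutions of `z' = v t (z, p)` that
start at a common stationary point `y₀`. With `z` the deviation of the solution and `q = p - p₀`,
the derivative of `l z + ∫ ρ` differs from `(l D_p v + D_p ρ) q` only by the errors of the
linearizations, so no variational equation for `z` is needed. -/
theorem hasFDerivAt_cost_of_adjoint {T : ℝ} (hT : 0 ≤ T) {v : ℝ → E × Q → E} {ρ : ℝ → E × Q → ℝ}
    {y₀ : E} {p₀ : Q} {D : ℝ → E × Q →L[ℝ] E} {R : ℝ → E × Q →L[ℝ] ℝ}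
    (hv : IsUniformLinearization (Icc 0 T) v (y₀, p₀) D) (hD : ContinuousOn D (Icc 0 T))
    (hv₀ : ∀ t ∈ Icc 0 T, v t (y₀, p₀) = 0)
    (hρ : IsUniformLinearization (Icc 0 T) ρ (y₀, p₀) R) (hR : ContinuousOn R (Icc 0 T))
    {l : ℝ → E →L[ℝ] ℝ}
    (hl : ∀ t ∈ Icc 0 T, HasDerivWithinAt l
      (-((l t).comp ((D t).comp (.inl ℝ E Q))) - (R t).comp (.inl ℝ E Q)) (Icc 0 T) t)
    {Φ : E × Q → ℝ} {Φ' : E × Q →L[ℝ] ℝ} (hΦ : HasFDerivAt Φ Φ' (y₀, p₀))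
    (hlT : l T = Φ'.comp (.inl ℝ E Q))
    {z : Q → ℝ → E} (hz0 : ∀ᶠ p in 𝓝 p₀, z p 0 = y₀)
    (hz : ∀ᶠ p in 𝓝 p₀, ∀ t ∈ Icc 0 T, HasDerivWithinAt (z p) (v t (z p t, p)) (Icc 0 T) t)
    {C : ℝ} (hzC : ∀ᶠ p in 𝓝 p₀, ∀ t ∈ Icc 0 T, ‖z p t - y₀‖ ≤ C * ‖p - p₀‖)
    (hρc : ∀ᶠ p in 𝓝 p₀, ContinuousOn (fun t => ρ t (z p t, p)) (Icc 0 T)) :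
    HasFDerivAt (fun p => Φ (z p T, p) + ∫ t in (0 : ℝ)..T, ρ t (z p t, p))
      (Φ'.comp (.inr ℝ E Q) +
        ∫ t in (0 : ℝ)..T, ((l t).comp ((D t).comp (.inr ℝ E Q)) + (R t).comp (.inr ℝ E Q)))
      p₀ := by
  have hlc : ContinuousOn l (Icc 0 T) := fun t ht => (hl t ht).continuousWithinAt
  obtain ⟨Λ, hΛ0, hΛ⟩ := exists_norm_bound hlc
  have hz₀ : ∀ t ∈ Icc 0 T, z p₀ t = y₀ := fun t ht => by
    simpa [sub_eq_zero] using hzC.self_of_nhds t ht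
  have hρ₀c : ContinuousOn (fun t => ρ t (y₀, p₀)) (Icc 0 T) :=
    hρc.self_of_nhds.congr fun t ht => by simp only [hz₀ t ht]
  set S : ℝ → Q →L[ℝ] ℝ := fun t =>
    (l t).comp ((D t).comp (.inr ℝ E Q)) + (R t).comp (.inr ℝ E Q) with hS
  have hSc : ContinuousOn S (Icc 0 T) :=
    (hlc.clm_comp (hD.clm_comp continuousOn_const)).add (hR.clm_comp continuousOn_const)
  have hSi : IntervalIntegrable S volume 0 T :=
    ContinuousOn.intervalIntegrable (by rwa [uIcc_of_le hT])
  have hx : Tendsto (fun p => (z p T, p)) (𝓝 p₀) (𝓝 (y₀, p₀)) := by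
    refine Tendsto.prodMk_nhds ?_ tendsto_id
    rw [tendsto_iff_norm_sub_tendsto_zero]
    refine squeeze_zero' (Eventually.of_forall fun _ => norm_nonneg _)
      (hzC.mono fun p hp => hp T ⟨hT, le_rfl⟩) ?_
    have : Continuous fun p => C * ‖p - p₀‖ := by fun_prop
    simpa using this.tendsto p₀
  have hdev : ∀ᶠ p in 𝓝 p₀, ∀ t ∈ Icc 0 T, ‖(z p t, p) - (y₀, p₀)‖ ≤ (|C| + 1) * ‖p - p₀‖ := by
    filter_upwards [hzC] with p hp t ht
    rw [Prod.mk_sub_mk]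
    refine max_le ((hp t ht).trans ?_) ?_
    · gcongr
      linarith [le_abs_self C]
    · simp only
      nlinarith [norm_nonneg (p - p₀), abs_nonneg C]
  have hunif : ∀ {A : E × Q → Prop}, (∀ᶠ x in 𝓝 (y₀, p₀), A x) →
      ∀ᶠ p in 𝓝 p₀, ∀ t ∈ Icc 0 T, A (z p t, p) := by
    intro A hA
    obtain ⟨δ, hδ, hball⟩ := Metric.eventually_nhds_iff.1 hA
    have hsmall : Tendsto (fun p => (|C| + 1) * ‖p - p₀‖) (𝓝 p₀) (𝓝 0) := by
      have : Continuous fun p => (|C| + 1) * ‖p - p₀‖ := by fun_prop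
      simpa using this.tendsto p₀
    filter_upwards [hdev, hsmall.eventually (gt_mem_nhds hδ)] with p hp hpδ t ht
    refine hball ?_
    rw [dist_eq_norm]
    exact (hp t ht).trans_lt hpδ
  -- Below, `φ` is the quantity whose derivative loses its first-order part in `z p t - y₀` by the adjoint
  -- equation; only the errors of the linearizations of `v` and `ρ` remain.
  have hvar : (fun p => l T (z p T - y₀) + ((∫ t in (0 : ℝ)..T, ρ t (z p t, p))
      - ∫ t in (0 : ℝ)..T, ρ t (y₀, p₀)) - (∫ t in (0 : ℝ)..T, S t) (p - p₀))
      =o[𝓝 p₀] fun p => p - p₀ := by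
    rw [isLittleO_iff]
    intro c hc
    set ε : ℝ := c / ((Λ + 1) * (|C| + 1) * (T + 1)) with hε
    have hε0 : 0 < ε := by positivity
    filter_upwards [hz0, hz, hρc, hdev, hunif (hv ε hε0), hunif (hρ ε hε0)]
      with p hz0 hz hρc hdev hvp hρp
    set k : ℝ → ℝ := fun t => ρ t (z p t, p) - ρ t (y₀, p₀) - S t (p - p₀) with hk
    have hkc : ContinuousOn k (Icc 0 T) :=
      (hρc.sub hρ₀c).sub (hSc.clm_apply continuousOn_const)
    have hint : ∀ {u : ℝ → ℝ}, ContinuousOn u (Icc 0 T) → IntervalIntegrable u volume 0 T :=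
      fun hu => ContinuousOn.intervalIntegrable (by rwa [uIcc_of_le hT])
    set φ : ℝ → ℝ := fun t => l t (z p t - y₀) + ∫ s in (0 : ℝ)..t, k s with hφ
    set x : ℝ → E × Q := fun t => (z p t, p) - (y₀, p₀) with hxdef
    have hφd : ∀ t ∈ Icc 0 T, HasDerivWithinAt φ
        (l t (v t (z p t, p) - v t (y₀, p₀) - D t (x t)) +
          (ρ t (z p t, p) - ρ t (y₀, p₀) - R t (x t))) (Icc 0 T) t := by
      intro t ht
      have : Fact (t ∈ Icc 0 T) := ⟨ht⟩
      have h1 := (hl t ht).clm_apply ((hz t ht).sub_const y₀)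
      have h2 : HasDerivWithinAt (fun t => ∫ s in (0 : ℝ)..t, k s) (k t) (Icc 0 T) t :=
        intervalIntegral.integral_hasDerivWithinAt_right
          ((hint hkc).mono_set (by
            rw [uIcc_of_le hT, uIcc_of_le ht.1]; exact Icc_subset_Icc_right ht.2))
          (hkc.stronglyMeasurableAtFilter_nhdsWithin measurableSet_Icc t) (hkc t ht)
      refine (h1.add h2).congr_deriv ?_
      have hxt : x t = ContinuousLinearMap.inl ℝ E Q (z p t - y₀)
          + ContinuousLinearMap.inr ℝ E Q (p - p₀) := by simp [hxdef]
      rw [hxt, hv₀ t ht]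
      simp only [hk, hS, sub_apply, add_apply, neg_apply, map_add, map_sub, map_zero,
        ContinuousLinearMap.comp_apply]
      ring
    have hφb : ∀ t ∈ Ico 0 T, ‖l t (v t (z p t, p) - v t (y₀, p₀) - D t (x t)) +
        (ρ t (z p t, p) - ρ t (y₀, p₀) - R t (x t))‖ ≤
        (Λ + 1) * (ε * ((|C| + 1) * ‖p - p₀‖)) := by
      intro t ht
      have ht' := Ico_subset_Icc_self ht
      rw [add_mul, one_mul]
      have hx' : ε * ‖x t‖ ≤ ε * ((|C| + 1) * ‖p - p₀‖) := by
        gcongr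
        exact hdev t ht'
      refine (norm_add_le _ _).trans (add_le_add (((l t).le_opNorm _).trans ?_)
        ((hρp t ht' t ht').trans hx'))
      gcongr
      · exact hΛ t ht'
      · exact (hvp t ht' t ht').trans hx'
    have hφT := norm_image_sub_le_of_norm_deriv_le_segment' hφd hφb T ⟨hT, le_rfl⟩
    have hφ0 : φ 0 = 0 := by simp [hφ, hz0]
    have hφ1 : φ T = l T (z p T - y₀) + ((∫ t in (0 : ℝ)..T, ρ t (z p t, p))
        - ∫ t in (0 : ℝ)..T, ρ t (y₀, p₀)) - (∫ t in (0 : ℝ)..T, S t) (p - p₀) := by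
      simp only [hφ, hk]
      rw [intervalIntegral.integral_sub ((hint hρc).sub (hint hρ₀c))
        (hint (hSc.clm_apply continuousOn_const)),
        intervalIntegral.integral_sub (hint hρc) (hint hρ₀c),
        ContinuousLinearMap.intervalIntegral_apply hSi]
      ring
    rw [← hφ1]
    rw [hφ0, sub_zero, sub_zero] at hφT
    refine hφT.trans ?_
    have hTT : T ≤ T + 1 := by linarith
    calc (Λ + 1) * (ε * ((|C| + 1) * ‖p - p₀‖)) * T
        ≤ (Λ + 1) * (ε * ((|C| + 1) * ‖p - p₀‖)) * (T + 1) := by gcongr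
      _ = c * ‖p - p₀‖ := by
        rw [hε]
        field_simp
  have hend : (fun p => Φ (z p T, p) - Φ (y₀, p₀) - Φ' ((z p T, p) - (y₀, p₀)))
      =o[𝓝 p₀] fun p => p - p₀ := by
    refine (hΦ.isLittleO.comp_tendsto hx).trans_isBigO (IsBigO.of_bound (|C| + 1) ?_)
    filter_upwards [hdev] with p hp using hp T ⟨hT, le_rfl⟩
  refine HasFDerivAt.of_isLittleO ((hend.add hvar).congr_left fun p => ?_)
  have h0 : (∫ t in (0 : ℝ)..T, ρ t (z p₀ t, p₀)) = ∫ t in (0 : ℝ)..T, ρ t (y₀, p₀) :=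
    intervalIntegral.integral_congr fun t ht => by
      rw [uIcc_of_le hT] at ht
      simp only [hz₀ t ht]
  have h1 : Φ' ((z p T, p) - (y₀, p₀)) = l T (z p T - y₀) + Φ'.comp (.inr ℝ E Q) (p - p₀) := by
    rw [hlT, ContinuousLinearMap.comp_apply, ContinuousLinearMap.comp_apply, ← map_add]
    simp
  rw [h0, h1, hz₀ T ⟨hT, le_rfl⟩, add_apply]
  ring

end Trajectories

/-- A curve that starts in `U` stays in `U` if, as long as it stays in `U`, it stays in a closed
subset of `U`. -/
lemma forall_mem_of_forall_Ico_mem_closed {M : Type*} [TopologicalSpace M] {c : ℝ → M} {T : ℝ}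
    (hc : ContinuousOn c (Icc 0 T)) {U K : Set M} (hU : IsOpen U) (hK : IsClosed K) (hKU : K ⊆ U)
    (h0 : c 0 ∈ U)
    (h : ∀ τ ∈ Icc 0 T, (∀ t ∈ Ico 0 τ, c t ∈ U) → ∀ t ∈ Ico 0 τ, c t ∈ K) :
    ∀ t ∈ Icc 0 T, c t ∈ U := by
  by_contra! hbad
  have hcl : IsCompact (Icc 0 T ∩ c ⁻¹' Uᶜ) :=
    isCompact_Icc.of_isClosed_subset
      (hc.preimage_isClosed_of_isClosed isClosed_Icc hU.isClosed_compl) inter_subset_left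
  obtain ⟨τ, hτ, hmin⟩ := hcl.exists_isLeast (by
    obtain ⟨t, ht, hct⟩ := hbad
    exact ⟨t, ht, hct⟩)
  have hlt : 0 < τ := by
    rcases hτ.1.1.eq_or_lt with h' | h'
    · exact absurd h0 (h' ▸ hτ.2)
    · exact h'
  have hin : ∀ t ∈ Ico 0 τ, c t ∈ U := fun t ht => by
    by_contra hct
    exact absurd (hmin ⟨⟨ht.1, ht.2.le.trans hτ.1.2⟩, hct⟩) (not_le.2 ht.2)
  have hKin := h τ hτ.1 hin
  have hcw : ContinuousWithinAt c (Ico 0 τ) τ :=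
    (hc τ hτ.1).mono fun t ht => ⟨ht.1, ht.2.le.trans hτ.1.2⟩
  have hmem : τ ∈ closure (Ico 0 τ) := by
    rw [closure_Ico hlt.ne]
    exact ⟨hlt.le, le_rfl⟩
  have := hcw.mem_closure hmem (fun t ht => hKin t ht)
  exact hτ.2 (hKU (hK.closure_eq ▸ this))

end FirstVariation

/-! ### Calculus in charts, and the multiplication in the chart at the identity -/

section ChartCalculus

open Filter Topology

variable {E : Type*} [NormedAddCommGroup E] [NormedSpace ℝ E]
  {M : Type*} [TopologicalSpace M] [ChartedSpace E M]
  {F : Type*} [NormedAddCommGroup F] [NormedSpace ℝ F]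

lemma hasFDerivAt_comp_extChartAt_symm {V : M → F} {x : M} {L : E →L[ℝ] F}
    (h : HasMFDerivAt 𝓘(ℝ, E) 𝓘(ℝ, F) V x L) :
    HasFDerivAt (fun y => V ((extChartAt 𝓘(ℝ, E) x).symm y)) L (extChartAt 𝓘(ℝ, E) x x) := by
  exact HasFDerivWithinAt.hasFDerivAt (s := range 𝓘(ℝ, E)) h.2 (by simp)

lemma hasMFDerivAt_of_comp_extChartAt_symm {V : M → F} {x : M} {L : E →L[ℝ] F}
    (h : HasFDerivAt (fun y => V ((extChartAt 𝓘(ℝ, E) x).symm y)) L (extChartAt 𝓘(ℝ, E) x x)) :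
    HasMFDerivAt 𝓘(ℝ, E) 𝓘(ℝ, F) V x L := by
  refine ⟨?_, ?_⟩
  · have h1 := ContinuousAt.comp (f := extChartAt 𝓘(ℝ, E) x) (x := x) h.continuousAt
      (continuousAt_extChartAt x)
    refine h1.congr ?_
    filter_upwards [extChartAt_source_mem_nhds (I := 𝓘(ℝ, E)) x] with y hy
    simp only [Function.comp_apply]
    rw [(extChartAt 𝓘(ℝ, E) x).left_inv hy]
  · exact HasFDerivAt.hasFDerivWithinAt (s := range 𝓘(ℝ, E)) h

lemma hasMFDerivAt_extChartAt_self [IsManifold 𝓘(ℝ, E) 1 M] (x : M) :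
    HasMFDerivAt 𝓘(ℝ, E) 𝓘(ℝ, E) (extChartAt 𝓘(ℝ, E) x) x (ContinuousLinearMap.id ℝ E) := by
  have h := (mdifferentiableAt_extChartAt (I := 𝓘(ℝ, E)) (mem_chart_source E x)).hasMFDerivAt
  rw [mfderiv_extChartAt_self] at h
  exact h

section UniformLinearization

variable {EN HN : Type*} [NormedAddCommGroup EN] [NormedSpace ℝ EN] [TopologicalSpace HN]
  {J : ModelWithCorners ℝ EN HN} {N : Type*} [TopologicalSpace N] [ChartedSpace HN N]
  {X : Type*} [NormedAddCommGroup X] [NormedSpace ℝ X]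

/-- The partial map of a `C¹` map on `N × X` is differentiable. -/
lemma differentiableAt_partial {F : Type*} [NormedAddCommGroup F] [NormedSpace ℝ F]
    {W : N × X → F} {n : N} {x : X}
    (hW : ContMDiffAt (J.prod 𝓘(ℝ, X)) 𝓘(ℝ, F) 1 W (n, x)) :
    DifferentiableAt ℝ (fun x => W (n, x)) x := by
  have h : ContMDiffAt 𝓘(ℝ, X) 𝓘(ℝ, F) 1 (fun x => W (n, x)) x :=
    ContMDiffAt.comp x (g := W) (f := fun x => (n, x)) hW
      (contMDiffAt_const.prodMk contMDiffAt_id)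
  exact (contMDiffAt_iff_contDiffAt.1 h).differentiableAt one_ne_zero

variable [J.Boundaryless] [IsManifold J 1 N]

/-- A `C¹` map on the product of a manifold and a normed space has a partial derivative along the
normed space, locally uniformly along the manifold. -/
lemma exists_eventually_norm_sub_le_of_contMDiffAt {W : N × X → F} {n₀ : N} {x₀ : X}
    (hW : ContMDiffAt (J.prod 𝓘(ℝ, X)) 𝓘(ℝ, F) 1 W (n₀, x₀)) :
    ∃ D : X →L[ℝ] F, ∀ ε > 0, ∀ᶠ z : N × X in 𝓝 (n₀, x₀),
      ‖W z - W (z.1, x₀) - D (z.2 - x₀)‖ ≤ ε * ‖z.2 - x₀‖ := by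
  set χ := extChartAt J n₀ with hχ
  have hsymm : ContMDiffAt 𝓘(ℝ, EN) J 1 χ.symm (χ n₀) :=
    (contMDiffOn_extChartAt_symm n₀).contMDiffAt
      ((isOpen_extChartAt_target n₀).mem_nhds (mem_extChartAt_target n₀))
  have h1 : ContMDiffAt 𝓘(ℝ, EN × X) (J.prod 𝓘(ℝ, X)) 1 (fun p : EN × X => (χ.symm p.1, p.2))
      (χ n₀, x₀) :=
    (hsymm.comp (χ n₀, x₀) contDiff_fst.contMDiff.contMDiffAt).prodMk
      contDiff_snd.contMDiff.contMDiffAt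
  have hx : (χ.symm (χ n₀), x₀) = (n₀, x₀) := by rw [hχ, extChartAt_to_inv]
  have h2 : ContDiffAt ℝ 1 (fun p : EN × X => W (χ.symm p.1, p.2)) (χ n₀, x₀) :=
    contMDiffAt_iff_contDiffAt.1 (ContMDiffAt.comp (χ n₀, x₀)
      (g := W) (f := fun p : EN × X => (χ.symm p.1, p.2)) (by rw [hx]; exact hW) h1)
  have h3 := h2.hasStrictFDerivAt one_ne_zero
  set L := fderiv ℝ (fun p : EN × X => W (χ.symm p.1, p.2)) (χ n₀, x₀)
  refine ⟨L.comp (.inr ℝ EN X), fun ε hε => ?_⟩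
  have h4 := h3.isLittleO.def hε
  have h5 : ContinuousAt (fun z : N × X => (((χ z.1, z.2) : EN × X), ((χ z.1, x₀) : EN × X)))
      (n₀, x₀) := by
    have : ContinuousAt (fun z : N × X => χ z.1) (n₀, x₀) :=
      ContinuousAt.comp (f := Prod.fst) (x := (n₀, x₀)) (continuousAt_extChartAt n₀)
        continuousAt_fst
    exact (this.prodMk continuousAt_snd).prodMk (this.prodMk continuousAt_const)
  have h6 : ∀ᶠ z : N × X in 𝓝 (n₀, x₀), z.1 ∈ χ.source :=
    continuousAt_fst.eventually (extChartAt_source_mem_nhds (I := J) n₀)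
  filter_upwards [h5.eventually h4, h6] with z hz hzs
  simpa [χ.left_inv hzs] using hz

/-- Along a continuous curve in the manifold, the partial derivatives of a `C¹` map form a locally
uniform linearization. -/
lemma isLocallyUniformLinearization_of_contMDiffAt {W : N × X → F} {x₀ : X} {K : Set ℝ}
    {σ : ℝ → N} (hσ : ContinuousOn σ K)
    (hW : ∀ t ∈ K, ContMDiffAt (J.prod 𝓘(ℝ, X)) 𝓘(ℝ, F) 1 W (σ t, x₀)) :
    IsLocallyUniformLinearization K (fun t x => W (σ t, x)) x₀
      (fun t => fderiv ℝ (fun x => W (σ t, x)) x₀) := by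
  intro t₀ ht₀ ε hε
  obtain ⟨D, hD⟩ := exists_eventually_norm_sub_le_of_contMDiffAt (hW t₀ ht₀)
  have hfd : HasFDerivAt (fun x => W (σ t₀, x)) D x₀ := by
    refine HasFDerivAt.of_isLittleO (Asymptotics.IsLittleO.of_bound fun c hc => ?_)
    have h := hD c hc
    rw [nhds_prod_eq] at h
    exact h.curry.self_of_nhds
  simp only [hfd.fderiv]
  have h1 : ∀ᶠ z : ℝ × X in 𝓝[K ×ˢ univ] (t₀, x₀),
      ‖W (σ z.1, z.2) - W (σ z.1, x₀) - D (z.2 - x₀)‖ ≤ ε * ‖z.2 - x₀‖ := by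
    have hc : Tendsto (fun z : ℝ × X => (σ z.1, z.2)) (𝓝[K ×ˢ univ] (t₀, x₀)) (𝓝 (σ t₀, x₀)) := by
      rw [nhdsWithin_prod_eq, nhdsWithin_univ, nhds_prod_eq]
      exact Tendsto.prodMap (hσ t₀ ht₀) tendsto_id
    exact hc.eventually (hD ε hε)
  rw [eventually_nhdsWithin_iff] at h1
  filter_upwards [h1] with z hz hzK using hz ⟨hzK, mem_univ _⟩

end UniformLinearization

end ChartCalculus

section LieGroupChart

open Filter Topology

variable {E : Type*} [NormedAddCommGroup E] [NormedSpace ℝ E]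
  {G : Type*} [TopologicalSpace G] [ChartedSpace E G] [Group G]

variable (E G) in
/-- The chart of `G` at the identity. -/
abbrev oneChart : PartialEquiv G E := extChartAt 𝓘(ℝ, E) (1 : G)

variable (E G) in
/-- The multiplication of `G`, read in the chart at the identity. -/
def chartMul (p : E × E) : E :=
  oneChart E G ((oneChart E G).symm p.1 * (oneChart E G).symm p.2)

lemma oneChart_mul {c d : G} (hc : c ∈ (oneChart E G).source) (hd : d ∈ (oneChart E G).source) :
    oneChart E G (c * d) = chartMul E G (oneChart E G c, oneChart E G d) := by
  rw [chartMul, (oneChart E G).left_inv hc, (oneChart E G).left_inv hd]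

@[simp] lemma oneChart_symm_oneChart_one : (oneChart E G).symm (oneChart E G 1) = 1 :=
  extChartAt_to_inv 1

lemma chartMul_one_left {y : E} (hy : y ∈ (oneChart E G).target) :
    chartMul E G (oneChart E G 1, y) = y := by
  rw [chartMul]
  simp only [oneChart_symm_oneChart_one, one_mul]
  exact (oneChart E G).right_inv hy

lemma chartMul_one_right {y : E} (hy : y ∈ (oneChart E G).target) :
    chartMul E G (y, oneChart E G 1) = y := by
  rw [chartMul]
  simp only [oneChart_symm_oneChart_one, mul_one]
  exact (oneChart E G).right_inv hy

lemma oneChart_target_mem_nhds {y : E} (hy : y ∈ (oneChart E G).target) :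
    (oneChart E G).target ∈ 𝓝 y :=
  (isOpen_extChartAt_target (I := 𝓘(ℝ, E)) (1 : G)).mem_nhds hy

lemma oneChart_one_mem_target : oneChart E G 1 ∈ (oneChart E G).target :=
  mem_extChartAt_target (I := 𝓘(ℝ, E)) (1 : G)

variable [LieGroup 𝓘(ℝ, E) ∞ G]

lemma contMDiffAt_oneChart_symm {y : E} (hy : y ∈ (oneChart E G).target) :
    ContMDiffAt 𝓘(ℝ, E) 𝓘(ℝ, E) ∞ (oneChart E G).symm y :=
  (contMDiffOn_extChartAt_symm (1 : G)).contMDiffAt (oneChart_target_mem_nhds hy)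

lemma contMDiffAt_oneChart {c : G} (hc : c ∈ (oneChart E G).source) :
    ContMDiffAt 𝓘(ℝ, E) 𝓘(ℝ, E) ∞ (oneChart E G) c :=
  contMDiffAt_extChartAt' (by rwa [extChartAt_source] at hc)

lemma contDiffAt_chartMul {x y : E} (hx : x ∈ (oneChart E G).target)
    (hy : y ∈ (oneChart E G).target)
    (hxy : (oneChart E G).symm x * (oneChart E G).symm y ∈ (oneChart E G).source) :
    ContDiffAt ℝ ∞ (chartMul E G) (x, y) := by
  rw [← contMDiffAt_iff_contDiffAt]
  have h1 : ContMDiffAt 𝓘(ℝ, E × E) 𝓘(ℝ, E) ∞ (fun p : E × E => (oneChart E G).symm p.1) (x, y) :=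
    ContMDiffAt.comp (x, y) (g := (oneChart E G).symm) (f := Prod.fst)
      (contMDiffAt_oneChart_symm hx) contDiff_fst.contMDiff.contMDiffAt
  have h2 : ContMDiffAt 𝓘(ℝ, E × E) 𝓘(ℝ, E) ∞ (fun p : E × E => (oneChart E G).symm p.2) (x, y) :=
    ContMDiffAt.comp (x, y) (g := (oneChart E G).symm) (f := Prod.snd)
      (contMDiffAt_oneChart_symm hy) contDiff_snd.contMDiff.contMDiffAt
  exact ContMDiffAt.comp (x, y) (g := oneChart E G)
    (f := fun p : E × E => (oneChart E G).symm p.1 * (oneChart E G).symm p.2)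
    (contMDiffAt_oneChart hxy) (h1.mul h2)

lemma contDiffAt_chartMul_one_left {y : E} (hy : y ∈ (oneChart E G).target) :
    ContDiffAt ℝ ∞ (chartMul E G) (oneChart E G 1, y) :=
  contDiffAt_chartMul oneChart_one_mem_target hy (by
    simpa using (oneChart E G).map_target hy)

lemma contDiffAt_chartMul_one_right {y : E} (hy : y ∈ (oneChart E G).target) :
    ContDiffAt ℝ ∞ (chartMul E G) (y, oneChart E G 1) :=
  contDiffAt_chartMul hy oneChart_one_mem_target (by
    simpa using (oneChart E G).map_target hy)

variable (E G) in
/-- The derivative at the identity of left multiplication by the point with coordinate `y`, read in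
the chart at the identity: `chartLeftMul E G y A` is the coordinate expression of the left-invariant
vector field of `A`. -/
def chartLeftMul (y : E) : E →L[ℝ] E :=
  (fderiv ℝ (chartMul E G) (y, oneChart E G 1)).comp (.inr ℝ E E)

variable (E G) in
/-- The derivative at the identity of right multiplication by the point with coordinate `y`, read in
the chart at the identity. -/
def chartRightMul (y : E) : E →L[ℝ] E :=
  (fderiv ℝ (chartMul E G) (oneChart E G 1, y)).comp (.inl ℝ E E)

lemma hasFDerivAt_chartMul_right {y : E} (hy : y ∈ (oneChart E G).target) :
    HasFDerivAt (fun w => chartMul E G (y, w)) (chartLeftMul E G y) (oneChart E G 1) :=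
  ((contDiffAt_chartMul_one_right hy).differentiableAt (by simp)).hasFDerivAt.comp _
    (hasFDerivAt_prodMk_right y (oneChart E G 1))

lemma fderiv_chartMul_one_left_comp_inr {y : E} (hy : y ∈ (oneChart E G).target) :
    (fderiv ℝ (chartMul E G) (oneChart E G 1, y)).comp (.inr ℝ E E) = .id ℝ E := by
  have h1 := ((contDiffAt_chartMul_one_left hy).differentiableAt (by simp)).hasFDerivAt.comp _
    (hasFDerivAt_prodMk_right (oneChart E G 1) y)
  refine h1.unique ((hasFDerivAt_id y).congr_of_eventuallyEq ?_)
  filter_upwards [oneChart_target_mem_nhds hy] with w hw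
  exact chartMul_one_left hw

lemma chartLeftMul_one : chartLeftMul E G (oneChart E G 1) = .id ℝ E :=
  fderiv_chartMul_one_left_comp_inr oneChart_one_mem_target

lemma chartRightMul_one : chartRightMul E G (oneChart E G 1) = .id ℝ E := by
  have hy := oneChart_one_mem_target (E := E) (G := G)
  have h1 := HasFDerivAt.comp (f := fun x => (x, oneChart E G 1)) _
    ((contDiffAt_chartMul_one_left hy).differentiableAt (by simp)).hasFDerivAt
    (hasFDerivAt_prodMk_left (oneChart E G 1) (oneChart E G 1))
  refine h1.unique ((hasFDerivAt_id _).congr_of_eventuallyEq ?_)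
  filter_upwards [oneChart_target_mem_nhds hy] with w hw
  exact chartMul_one_right hw

lemma contDiffAt_chartLeftMul : ContDiffAt ℝ 1 (chartLeftMul E G) (oneChart E G 1) := by
  have h := ((contDiffAt_chartMul_one_right
    (oneChart_one_mem_target (E := E) (G := G))).fderiv_right (m := 1) (by norm_cast)).comp (oneChart E G 1)
    (f := fun y => (y, oneChart E G 1)) (contDiff_id.prodMk contDiff_const).contDiffAt
  exact h.clm_comp contDiffAt_const

lemma contDiffAt_chartRightMul : ContDiffAt ℝ 1 (chartRightMul E G) (oneChart E G 1) := by
  have h := ((contDiffAt_chartMul_one_left (oneChart_one_mem_target (E := E) (G := G))).fderiv_right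
    (m := 1) (by norm_cast)).comp (oneChart E G 1)
    (f := fun y => (oneChart E G 1, y)) (contDiff_const.prodMk contDiff_id).contDiffAt
  exact h.clm_comp contDiffAt_const

/-- The mixed second derivative of the multiplication at the identity, computed in either order. -/
lemma fderiv_chartRightMul_apply (A B : E) :
    fderiv ℝ (fun y => chartRightMul E G y A) (oneChart E G 1) B =
      fderiv ℝ (fun y => chartLeftMul E G y B) (oneChart E G 1) A := by
  set y₀ := oneChart E G 1
  have hm := contDiffAt_chartMul_one_left (oneChart_one_mem_target (E := E) (G := G))
  have hd : HasFDerivAt (fderiv ℝ (chartMul E G)) (fderiv ℝ (fderiv ℝ (chartMul E G)) (y₀, y₀))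
      (y₀, y₀) :=
    ((hm.fderiv_right (m := 1) (by norm_cast)).differentiableAt one_ne_zero).hasFDerivAt
  have hR : HasFDerivAt (fun y => chartRightMul E G y A)
      ((ContinuousLinearMap.apply ℝ E ((A, 0) : E × E)).comp
        ((fderiv ℝ (fderiv ℝ (chartMul E G)) (y₀, y₀)).comp (.inr ℝ E E))) y₀ :=
    (ContinuousLinearMap.apply ℝ E ((A, 0) : E × E)).hasFDerivAt.comp y₀
      (hd.comp y₀ (hasFDerivAt_prodMk_right y₀ y₀))
  have hL : HasFDerivAt (fun y => chartLeftMul E G y B)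
      ((ContinuousLinearMap.apply ℝ E ((0, B) : E × E)).comp
        ((fderiv ℝ (fderiv ℝ (chartMul E G)) (y₀, y₀)).comp (.inl ℝ E E))) y₀ :=
    (ContinuousLinearMap.apply ℝ E ((0, B) : E × E)).hasFDerivAt.comp y₀
      (HasFDerivAt.comp (f := fun y => (y, y₀)) y₀ hd (hasFDerivAt_prodMk_left y₀ y₀))
  rw [hR.fderiv, hL.fderiv]
  have hs := (hm.isSymmSndFDerivAt (by
    rw [minSmoothness_of_isRCLikeNormedField]; norm_cast)) (0, B) (A, 0)
  change fderiv ℝ (fderiv ℝ (chartMul E G)) (y₀, y₀) (0, B) (A, 0) =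
    fderiv ℝ (fderiv ℝ (chartMul E G)) (y₀, y₀) (A, 0) (0, B)
  exact hs

end LieGroupChart

/-! ### Left trivialization, Lie bracket and deviation of two curves -/

section LeftTrivialization

open Filter Topology Bundle

variable {E : Type*} [NormedAddCommGroup E] [NormedSpace ℝ E]
  {G : Type*} [TopologicalSpace G] [ChartedSpace E G] [Group G] [LieGroup 𝓘(ℝ, E) ∞ G]
  {F : Type*} [NormedAddCommGroup F] [NormedSpace ℝ F]

/-- In the preferred trivialization over a point equal to `1`, a tangent vector at the identity is
its own coordinate. The points are kept as variables, since in applications they are of the form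
`a⁻¹ * a`. -/
lemma trivializationAt_snd_of_eq_one {a b : G} (ha : a = 1) (hb : b = 1)
    (w : E) :
    (trivializationAt E (TangentSpace 𝓘(ℝ, E)) a
      (⟨b, w⟩ : TangentBundle 𝓘(ℝ, E) G)).2 = w := by
  subst ha hb
  exact (tangentBundleCore 𝓘(ℝ, E) G).coordChange_self (achart E 1) 1 (mem_chart_source E 1) w

/-- The left-trivialized tangent vector `(L_{a⁻¹})_* v`, as a vector of the model space `E` of the
tangent space at the identity. -/
def leftCoord (a : G) (v : TangentSpace 𝓘(ℝ, E) a) : E := leftTrivialize a v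

lemma hasMFDerivAt_mul_left (a b : G) :
    HasMFDerivAt 𝓘(ℝ, E) 𝓘(ℝ, E) (fun h : G => a * h) b
      (mfderiv 𝓘(ℝ, E) 𝓘(ℝ, E) (fun h : G => a * h) b) :=
  ((contMDiff_mul_left (I := 𝓘(ℝ, E)) (n := ∞) (a := a)).mdifferentiable
    (by simp) b).hasMFDerivAt

/-- The left-trivialized gradient `(L_a)^* dV(a)`, as a covector of the model space `E` of the
tangent space at the identity. -/
def leftGradCoord (V : G → ℝ) (a : G) : E →L[ℝ] ℝ := leftGrad V a

/-- The gradient in the left trivialization is the derivative in the chart at the identity,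
translated to `a`. -/
lemma hasFDerivAt_leftGrad {V : G → ℝ} {a : G} (hV : MDifferentiableAt 𝓘(ℝ, E) 𝓘(ℝ, ℝ) V a) :
    HasFDerivAt (fun y => V (a * (oneChart E G).symm y)) (leftGradCoord V a)
      (oneChart E G 1) := by
  have key : ∀ b, b = a → HasMFDerivAt 𝓘(ℝ, E) 𝓘(ℝ, ℝ) V b
      (show TangentSpace 𝓘(ℝ, E) b →L[ℝ] ℝ from mfderiv 𝓘(ℝ, E) 𝓘(ℝ, ℝ) V a) := by
    rintro _ rfl
    exact hV.hasMFDerivAt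
  exact hasFDerivAt_comp_extChartAt_symm
    ((key (a * 1) (mul_one a)).comp (1 : G) (hasMFDerivAt_mul_left a 1))

/-- The coordinate of `c(t)⁻¹ c(τ)` has, at `τ = t`, the left-trivialized velocity of `c` as its
derivative. -/
lemma hasDerivWithinAt_oneChart_inv_mul {c : ℝ → G} {s : Set ℝ} {t : ℝ}
    {v : TangentSpace 𝓘(ℝ, E) (c t)}
    (hc : HasMFDerivWithinAt 𝓘(ℝ, ℝ) 𝓘(ℝ, E) c s t ((1 : ℝ →L[ℝ] ℝ).smulRight v)) :
    HasDerivWithinAt (fun τ => oneChart E G ((c t)⁻¹ * c τ)) (leftCoord (c t) v) s t := by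
  have key : ∀ b : G, b = 1 → HasMFDerivAt 𝓘(ℝ, E) 𝓘(ℝ, E) (oneChart E G) b
      (show TangentSpace 𝓘(ℝ, E) b →L[ℝ] E from ContinuousLinearMap.id ℝ E) := by
    rintro _ rfl
    exact hasMFDerivAt_extChartAt_self (1 : G)
  have h := HasMFDerivAt.comp_hasMFDerivWithinAt t
    ((key ((c t)⁻¹ * c t) (inv_mul_cancel _)).comp (c t) (hasMFDerivAt_mul_left (c t)⁻¹ (c t))) hc
  have h' : HasFDerivWithinAt (fun τ => oneChart E G ((c t)⁻¹ * c τ))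
      ((1 : ℝ →L[ℝ] ℝ).smulRight (leftCoord (c t) v)) s t := by
    refine HasFDerivWithinAt.congr_fderiv (hasMFDerivWithinAt_iff_hasFDerivWithinAt.1 h) ?_
    ext
    change mfderiv 𝓘(ℝ, E) 𝓘(ℝ, E) (fun h : G => (c t)⁻¹ * h) (c t) ((1 : ℝ) • v) =
      (1 : ℝ) • leftCoord (c t) v
    rw [one_smul, one_smul]
    rfl
  simpa using h'.hasDerivWithinAt

lemma mulInvariantVectorField_leftTrivialize (a : G) (v : TangentSpace 𝓘(ℝ, E) a) :
    mulInvariantVectorField (leftTrivialize a v) a = v := by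
  have key : ∀ b : G, b = 1 → HasMFDerivAt 𝓘(ℝ, E) 𝓘(ℝ, E) (fun h : G => a * h) b
      (show E →L[ℝ] E from mfderiv 𝓘(ℝ, E) 𝓘(ℝ, E) (fun h : G => a * h) 1) := by
    rintro _ rfl
    exact hasMFDerivAt_mul_left a 1
  have h := (key (a⁻¹ * a) (inv_mul_cancel a)).comp a (hasMFDerivAt_mul_left a⁻¹ a)
  have hid : (fun h : G => a * h) ∘ (fun h : G => a⁻¹ * h) = id := by
    funext x
    simp
  rw [hid] at h
  exact DFunLike.congr_fun (hasMFDerivAt_unique h (hasMFDerivAt_id a)) v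

/-- The left trivialization of the tangent bundle is of class `C¹`: it is the tangent map of
`(a, b) ↦ a⁻¹ b`, restricted to vectors `(0, v)` over the diagonal. -/
lemma contMDiff_leftTrivialize :
    ContMDiff 𝓘(ℝ, E).tangent 𝓘(ℝ, E) 1
      (fun v : TangentBundle 𝓘(ℝ, E) G => leftCoord v.1 v.2) := by
  have hdiv : ContMDiff (𝓘(ℝ, E).prod 𝓘(ℝ, E)) 𝓘(ℝ, E) ∞ (fun p : G × G => p.1⁻¹ * p.2) :=
    contMDiff_fst.inv.mul contMDiff_snd
  have h0 : ContMDiff 𝓘(ℝ, E).tangent 𝓘(ℝ, E).tangent 1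
      (fun v : TangentBundle 𝓘(ℝ, E) G => (⟨v.1, 0⟩ : TangentBundle 𝓘(ℝ, E) G)) :=
    (contMDiff_zeroSection ℝ (TangentSpace 𝓘(ℝ, E) : G → Type _)).comp
      (contMDiff_proj (TangentSpace 𝓘(ℝ, E)))
  have h1 := (contMDiff_equivTangentBundleProd_symm (n := 1) (I := 𝓘(ℝ, E)) (M := G)
    (I' := 𝓘(ℝ, E)) (M' := G)).comp (h0.prodMk contMDiff_id)
  have h2 := (hdiv.contMDiff_tangentMap (m := 1) (by norm_cast)).comp h1
  intro v₀
  have h3 := (contMDiffAt_totalSpace.1 (h2 v₀)).2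
  refine h3.congr_of_eventuallyEq (Eventually.of_forall fun v => ?_)
  refine Eq.trans ?_
    (trivializationAt_snd_of_eq_one (inv_mul_cancel v₀.1) (inv_mul_cancel v.1) _).symm
  change _ = mfderiv (𝓘(ℝ, E).prod 𝓘(ℝ, E)) 𝓘(ℝ, E) (fun p : G × G => p.1⁻¹ * p.2) (v.1, v.1)
    (0, v.2)
  have hsum := mfderiv_prod_eq_add_apply (p := (v.1, v.1)) (v := ((0, v.2) : E × E))
    (hdiv.mdifferentiable (by simp) (v.1, v.1))
  exact (hsum.trans ((congrArg (· + _) (map_zero _)).trans (zero_add _))).symm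

/-- The bracket of `𝔤` is the antisymmetrized second derivative of the multiplication at the
identity. -/
lemma lie_eq_fderiv_chartLeftMul (A B : LieAlg E G) :
    (⁅A, B⁆ : LieAlg E G) =
      (fderiv ℝ (fun y => chartLeftMul E G y B) (oneChart E G 1) A -
        fderiv ℝ (fun y => chartLeftMul E G y A) (oneChart E G 1) B : E) := by
  -- By definition the bracket is that of the pullbacks of the left-invariant fields to the chart,
  -- which agree with `chartLeftMul` near the identity.
  let pull : LieAlg E G → E → E := fun C y =>
    (mfderivWithin 𝓘(ℝ, E) 𝓘(ℝ, E) (oneChart E G).symm (range 𝓘(ℝ, E)) y).inverse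
      (mulInvariantVectorField C ((oneChart E G).symm y))
  have hlocal : ∀ C : LieAlg E G,
      pull C =ᶠ[𝓝 (oneChart E G 1)] fun y => chartLeftMul E G y C := by
    intro C
    filter_upwards [oneChart_target_mem_nhds oneChart_one_mem_target] with y hy
    have hinv : (mfderivWithin 𝓘(ℝ, E) 𝓘(ℝ, E) (oneChart E G).symm (range 𝓘(ℝ, E)) y).inverse =
        mfderiv 𝓘(ℝ, E) 𝓘(ℝ, E) (oneChart E G) ((oneChart E G).symm y) :=
      ContinuousLinearMap.inverse_eq
        (mfderivWithin_extChartAt_symm_comp_mfderiv_extChartAt hy)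
        (mfderiv_extChartAt_comp_mfderivWithin_extChartAt_symm hy)
    have key : ∀ c b : G, b = c → c ∈ (oneChart E G).source →
        HasMFDerivAt 𝓘(ℝ, E) 𝓘(ℝ, E) (oneChart E G) b
          (show TangentSpace 𝓘(ℝ, E) b →L[ℝ] E from
            mfderiv 𝓘(ℝ, E) 𝓘(ℝ, E) (oneChart E G) c) := by
      rintro c _ rfl hc
      exact ((contMDiffAt_oneChart hc).mdifferentiableAt (by simp)).hasMFDerivAt
    have h := hasFDerivAt_comp_extChartAt_symm
      ((key ((oneChart E G).symm y) ((oneChart E G).symm y * 1) (mul_one _)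
        ((oneChart E G).map_target hy)).comp (1 : G) (hasMFDerivAt_mul_left _ 1))
    have h' := h.unique (hasFDerivAt_chartMul_right hy)
    exact (DFunLike.congr_fun hinv _).trans (DFunLike.congr_fun h' C)
  change (mfderiv 𝓘(ℝ, E) 𝓘(ℝ, E) (oneChart E G) 1).inverse
    (VectorField.lieBracketWithin (E := E) ℝ (pull A) (pull B)
      ((oneChart E G).symm ⁻¹' univ ∩ range 𝓘(ℝ, E)) (oneChart E G 1)) = _
  have hinv : (mfderiv 𝓘(ℝ, E) 𝓘(ℝ, E) (oneChart E G) 1).inverse = ContinuousLinearMap.id ℝ E := by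
    rw [mfderiv_extChartAt_self]
    exact ContinuousLinearMap.inverse_id
  refine (DFunLike.congr_fun hinv _).trans ?_
  have hs : (oneChart E G).symm ⁻¹' univ ∩ range 𝓘(ℝ, E) = univ := by simp
  rw [hs]
  have hbr : VectorField.lieBracketWithin (E := E) ℝ (pull A) (pull B) univ (oneChart E G 1) =
      fderiv ℝ (fun y => chartLeftMul E G y B) (oneChart E G 1) A -
        fderiv ℝ (fun y => chartLeftMul E G y A) (oneChart E G 1) B := by
    rw [VectorField.lieBracketWithin_univ, (hlocal A).lieBracket_vectorField_eq (hlocal B),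
      VectorField.lieBracket_eq]
    simp only [chartLeftMul_one]
    rfl
  exact hbr

/-- The equation of motion of the deviation `a(τ)⁻¹ b(τ)` of two curves, read in the chart at the
identity: with `y` the coordinate of the deviation, `u` and `w` the left-trivialized velocities of
`a` and `b`, it is `y' = (L_y)_* w - (R_y)_* u`. -/
lemma hasDerivWithinAt_deviation {a b : ℝ → G} {s : Set ℝ} {t : ℝ} (ht : t ∈ s)
    {u : TangentSpace 𝓘(ℝ, E) (a t)} {w : TangentSpace 𝓘(ℝ, E) (b t)}
    (ha : HasMFDerivWithinAt 𝓘(ℝ, ℝ) 𝓘(ℝ, E) a s t ((1 : ℝ →L[ℝ] ℝ).smulRight u))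
    (hb : HasMFDerivWithinAt 𝓘(ℝ, ℝ) 𝓘(ℝ, E) b s t ((1 : ℝ →L[ℝ] ℝ).smulRight w))
    (hab : (a t)⁻¹ * b t ∈ (oneChart E G).source) :
    HasDerivWithinAt (fun τ => oneChart E G ((a τ)⁻¹ * b τ))
      (chartLeftMul E G (oneChart E G ((a t)⁻¹ * b t)) (leftCoord (b t) w) -
        chartRightMul E G (oneChart E G ((a t)⁻¹ * b t)) (leftCoord (a t) u)) s t := by
  -- At an isolated point of `s` every derivative condition holds.
  by_cases hacc : AccPt t (𝓟 s)
  swap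
  · exact HasFDerivWithinAt.of_not_accPt hacc
  have hud : UniqueDiffWithinAt ℝ s t := hacc.uniqueDiffWithinAt
  set y : ℝ → E := fun τ => oneChart E G ((a τ)⁻¹ * b τ) with hy
  have hyt : y t ∈ (oneChart E G).target := (oneChart E G).map_source hab
  have hdiff : MDifferentiableWithinAt 𝓘(ℝ, ℝ) 𝓘(ℝ, E) (fun τ => (a τ)⁻¹ * b τ) s t := by
    have hdiv : ContMDiff (𝓘(ℝ, E).prod 𝓘(ℝ, E)) 𝓘(ℝ, E) ∞ (fun p : G × G => p.1⁻¹ * p.2) :=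
      contMDiff_fst.inv.mul contMDiff_snd
    exact MDifferentiableAt.comp_mdifferentiableWithinAt t
      (g := fun p : G × G => p.1⁻¹ * p.2) (f := fun τ => (a τ, b τ))
      (hdiv.mdifferentiable (by simp) _)
      (ha.mdifferentiableWithinAt.prodMk hb.mdifferentiableWithinAt)
  have hyd : DifferentiableWithinAt ℝ y s t :=
    mdifferentiableWithinAt_iff_differentiableWithinAt.1
      (MDifferentiableAt.comp_mdifferentiableWithinAt t
        ((contMDiffAt_oneChart hab).mdifferentiableAt (by simp)) hdiff)
  have hka := hasDerivWithinAt_oneChart_inv_mul ha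
  have hkb := hasDerivWithinAt_oneChart_inv_mul hb
  have hka0 : oneChart E G ((a t)⁻¹ * a t) = oneChart E G 1 := by rw [inv_mul_cancel]
  have hkb0 : oneChart E G ((b t)⁻¹ * b t) = oneChart E G 1 := by rw [inv_mul_cancel]
  have : IsTopologicalGroup G := topologicalGroup_of_lieGroup 𝓘(ℝ, E) ∞
  have hsrc : (oneChart E G).source ∈ 𝓝 (1 : G) := extChartAt_source_mem_nhds (1 : G)
  have hsa : ∀ᶠ τ in 𝓝[s] t, (a t)⁻¹ * a τ ∈ (oneChart E G).source :=
    (continuousWithinAt_const.mul ha.1).tendsto.eventually (by simpa using hsrc)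
  have hsb : ∀ᶠ τ in 𝓝[s] t, (b t)⁻¹ * b τ ∈ (oneChart E G).source :=
    (continuousWithinAt_const.mul hb.1).tendsto.eventually (by simpa using hsrc)
  have hsy : ∀ᶠ τ in 𝓝[s] t, (a τ)⁻¹ * b τ ∈ (oneChart E G).source :=
    hdiff.continuousWithinAt.eventually
      ((isOpen_extChartAt_source (I := 𝓘(ℝ, E)) (1 : G)).mem_nhds hab)
  -- Both sides of `m (a(t)⁻¹ a(τ), y(τ)) = m (y(t), b(t)⁻¹ b(τ))`, in which `m` is the
  -- multiplication in the chart, are the coordinate of `a(t)⁻¹ b(τ)`.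
  have heq : ∀ᶠ τ in 𝓝[s] t, chartMul E G (oneChart E G ((a t)⁻¹ * a τ), y τ) =
      chartMul E G (y t, oneChart E G ((b t)⁻¹ * b τ)) := by
    filter_upwards [hsa, hsb, hsy] with τ h1 h2 h3
    rw [← oneChart_mul h1 h3, ← oneChart_mul hab h2]
    congr 1
    group
  have hm1 := ((contDiffAt_chartMul_one_left hyt).differentiableAt (by simp)).hasFDerivAt
  have hm2 := ((contDiffAt_chartMul_one_right hyt).differentiableAt (by simp)).hasFDerivAt
  have h1 : HasDerivWithinAt (fun τ => chartMul E G (oneChart E G ((a t)⁻¹ * a τ), y τ))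
      (fderiv ℝ (chartMul E G) (oneChart E G 1, y t)
        (leftCoord (a t) u, derivWithin y s t)) s t :=
    HasFDerivAt.comp_hasDerivWithinAt_of_eq t hm1 (hka.prodMk hyd.hasDerivWithinAt)
      (by rw [hka0])
  have h2 : HasDerivWithinAt (fun τ => chartMul E G (y t, oneChart E G ((b t)⁻¹ * b τ)))
      (fderiv ℝ (chartMul E G) (y t, oneChart E G 1) (0, leftCoord (b t) w)) s t :=
    HasFDerivAt.comp_hasDerivWithinAt_of_eq t hm2 ((hasDerivWithinAt_const t s _).prodMk hkb)
      (by rw [hkb0])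
  have h3 := hud.eq_deriv s h1 (h2.congr_of_eventuallyEq heq (heq.self_of_nhdsWithin ht))
  have h4 : fderiv ℝ (chartMul E G) (oneChart E G 1, y t) (leftCoord (a t) u, derivWithin y s t) =
      chartRightMul E G (y t) (leftCoord (a t) u) + derivWithin y s t := by
    have h5 := DFunLike.congr_fun (fderiv_chartMul_one_left_comp_inr hyt) (derivWithin y s t)
    have h6 : ((leftCoord (a t) u, derivWithin y s t) : E × E) =
        ContinuousLinearMap.inl ℝ E E (leftCoord (a t) u) +
          ContinuousLinearMap.inr ℝ E E (derivWithin y s t) := by simp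
    rw [h6, map_add]
    exact congrArg _ h5
  rw [h4] at h3
  refine hyd.hasDerivWithinAt.congr_deriv ?_
  exact eq_sub_of_add_eq' h3

end LeftTrivialization

/-! ### The perturbed problem in local coordinates -/

section LocalCoordinates

open Filter Topology

variable {E : Type*} [NormedAddCommGroup E] [NormedSpace ℝ E]
  {G : Type*} [TopologicalSpace G] [ChartedSpace E G] [Group G]
  {EΘ : Type*} [NormedAddCommGroup EΘ] [NormedSpace ℝ EΘ]
  {Θ : Type*} [TopologicalSpace Θ] [ChartedSpace EΘ Θ]

variable (E G EΘ) in
/-- The coordinates of the unperturbed configuration: no deviation, parameter `θ`. -/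
def basePoint (θ : Θ) : E × EΘ := (oneChart E G 1, extChartAt 𝓘(ℝ, EΘ) θ θ)

/-- The point `(a c, η, t)` of `G × Θ × ℝ`, where `y` is the coordinate of `c` in the chart at the
identity and `p` the coordinate of `η` in the chart at `θ`, as a function of `((a, t), (y, p))`. -/
def nearPoint (θ : Θ) (z : (G × ℝ) × (E × EΘ)) : G × Θ × ℝ :=
  (z.1.1 * (oneChart E G).symm z.2.1, (extChartAt 𝓘(ℝ, EΘ) θ).symm z.2.2, z.1.2)

/-- The left-trivialized vector field near the point `(a, θ, t)`. -/
def localVelocity (f : Θ → (h : G) → ℝ → TangentSpace 𝓘(ℝ, E) h) (θ : Θ)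
    (z : (G × ℝ) × (E × EΘ)) : E :=
  leftCoord (nearPoint θ z).1 (f (nearPoint θ z).2.1 (nearPoint θ z).1 (nearPoint θ z).2.2)

/-- The running cost near the point `(a, θ, t)`. -/
def localCost (r : G → Θ → ℝ → ℝ) (θ : Θ) (z : (G × ℝ) × (E × EΘ)) : ℝ :=
  r (nearPoint θ z).1 (nearPoint θ z).2.1 (nearPoint θ z).2.2

/-- The velocity of the coordinate `y` of the deviation `a⁻¹ b`, when `a` moves along `f θ` and `b`
moves along the vector field with the perturbed parameter. -/
def deviationField (f : Θ → (h : G) → ℝ → TangentSpace 𝓘(ℝ, E) h) (θ : Θ)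
    (z : (G × ℝ) × (E × EΘ)) : E :=
  chartLeftMul E G z.2.1 (localVelocity f θ z) -
    chartRightMul E G z.2.1 (localVelocity f θ (z.1, basePoint E G EΘ θ))

lemma nearPoint_basePoint (θ : Θ) (n : G × ℝ) :
    nearPoint θ (n, basePoint E G EΘ θ) = (n.1, θ, n.2) := by
  rw [nearPoint, basePoint]
  simp only [mul_one, extChartAt_to_inv]

lemma localVelocity_basePoint (f : Θ → (h : G) → ℝ → TangentSpace 𝓘(ℝ, E) h) (θ : Θ)
    (n : G × ℝ) : localVelocity f θ (n, basePoint E G EΘ θ) = leftCoord n.1 (f θ n.1 n.2) := by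
  have : ∀ q : G × Θ × ℝ, q = (n.1, θ, n.2) →
      leftCoord q.1 (f q.2.1 q.1 q.2.2) = leftCoord n.1 (f θ n.1 n.2) := by
    rintro _ rfl
    rfl
  exact this _ (nearPoint_basePoint θ n)

variable [LieGroup 𝓘(ℝ, E) ∞ G]

lemma deviationField_basePoint (f : Θ → (h : G) → ℝ → TangentSpace 𝓘(ℝ, E) h) (θ : Θ)
    (n : G × ℝ) : deviationField f θ (n, basePoint E G EΘ θ) = 0 := by
  change chartLeftMul E G (oneChart E G 1) _ - chartRightMul E G (oneChart E G 1) _ = 0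
  rw [chartLeftMul_one, chartRightMul_one, sub_self]

section Regularity

variable {f : Θ → (h : G) → ℝ → TangentSpace 𝓘(ℝ, E) h}
  (hf : ContMDiff (𝓘(ℝ, E).prod (𝓘(ℝ, EΘ).prod 𝓘(ℝ, ℝ))) 𝓘(ℝ, E).tangent 1
    (fun p : G × Θ × ℝ => (⟨p.1, f p.2.1 p.1 p.2.2⟩ : TangentBundle 𝓘(ℝ, E) G)))
  {r : G → Θ → ℝ → ℝ}
  (hr : ContMDiff (𝓘(ℝ, E).prod (𝓘(ℝ, EΘ).prod 𝓘(ℝ, ℝ))) 𝓘(ℝ, ℝ) 1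
    (fun p : G × Θ × ℝ => r p.1 p.2.1 p.2.2))

include hf in
lemma contMDiff_leftCoord :
    ContMDiff (𝓘(ℝ, E).prod (𝓘(ℝ, EΘ).prod 𝓘(ℝ, ℝ))) 𝓘(ℝ, E) 1
      (fun p : G × Θ × ℝ => leftCoord p.1 (f p.2.1 p.1 p.2.2)) :=
  contMDiff_leftTrivialize.comp hf

variable [IsManifold 𝓘(ℝ, EΘ) ∞ Θ]

lemma contMDiffAt_nearPoint (θ : Θ) (n : G × ℝ) :
    ContMDiffAt ((𝓘(ℝ, E).prod 𝓘(ℝ, ℝ)).prod 𝓘(ℝ, E × EΘ)) (𝓘(ℝ, E).prod (𝓘(ℝ, EΘ).prod 𝓘(ℝ, ℝ)))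
      1 (nearPoint θ) (n, basePoint E G EΘ θ) := by
  have hy : ContMDiffAt ((𝓘(ℝ, E).prod 𝓘(ℝ, ℝ)).prod 𝓘(ℝ, E × EΘ)) 𝓘(ℝ, E) 1
      (fun z : (G × ℝ) × (E × EΘ) => (oneChart E G).symm z.2.1) (n, basePoint E G EΘ θ) :=
    ContMDiffAt.comp (n, basePoint E G EΘ θ) (g := (oneChart E G).symm)
      (f := fun z : (G × ℝ) × (E × EΘ) => z.2.1)
      ((contMDiffAt_oneChart_symm oneChart_one_mem_target).of_le (by norm_cast))
      (contDiff_fst.contMDiff.contMDiffAt.comp _ contMDiffAt_snd)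
  have hψ : ContMDiffAt 𝓘(ℝ, EΘ) 𝓘(ℝ, EΘ) 1 (extChartAt 𝓘(ℝ, EΘ) θ).symm
      (extChartAt 𝓘(ℝ, EΘ) θ θ) :=
    ((contMDiffOn_extChartAt_symm (n := ∞) θ).contMDiffAt
      ((isOpen_extChartAt_target θ).mem_nhds (mem_extChartAt_target θ))).of_le (by norm_cast)
  have hp : ContMDiffAt ((𝓘(ℝ, E).prod 𝓘(ℝ, ℝ)).prod 𝓘(ℝ, E × EΘ)) 𝓘(ℝ, EΘ) 1
      (fun z : (G × ℝ) × (E × EΘ) => (extChartAt 𝓘(ℝ, EΘ) θ).symm z.2.2) (n, basePoint E G EΘ θ) :=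
    ContMDiffAt.comp (n, basePoint E G EΘ θ) (g := (extChartAt 𝓘(ℝ, EΘ) θ).symm)
      (f := fun z : (G × ℝ) × (E × EΘ) => z.2.2) hψ
      (contDiff_snd.contMDiff.contMDiffAt.comp _ contMDiffAt_snd)
  have hmul : ContMDiff (𝓘(ℝ, E).prod 𝓘(ℝ, E)) 𝓘(ℝ, E) 1 (fun p : G × G => p.1 * p.2) :=
    (contMDiff_mul 𝓘(ℝ, E) ∞).of_le (by norm_cast)
  exact (hmul.contMDiffAt.comp (n, basePoint E G EΘ θ)
    ((contMDiffAt_fst.comp _ contMDiffAt_fst).prodMk hy)).prodMk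
    (hp.prodMk (contMDiffAt_snd.comp _ contMDiffAt_fst))

include hf in
lemma contMDiffAt_localVelocity (θ : Θ) (n : G × ℝ) :
    ContMDiffAt ((𝓘(ℝ, E).prod 𝓘(ℝ, ℝ)).prod 𝓘(ℝ, E × EΘ)) 𝓘(ℝ, E) 1 (localVelocity f θ)
      (n, basePoint E G EΘ θ) :=
  (contMDiff_leftCoord hf).contMDiffAt.comp (n, basePoint E G EΘ θ) (contMDiffAt_nearPoint θ n)

include hr in
lemma contMDiffAt_localCost (θ : Θ) (n : G × ℝ) :
    ContMDiffAt ((𝓘(ℝ, E).prod 𝓘(ℝ, ℝ)).prod 𝓘(ℝ, E × EΘ)) 𝓘(ℝ, ℝ) 1 (localCost r θ)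
      (n, basePoint E G EΘ θ) :=
  hr.contMDiffAt.comp (n, basePoint E G EΘ θ) (contMDiffAt_nearPoint θ n)

include hf in
lemma contMDiffAt_deviationField (θ : Θ) (n : G × ℝ) :
    ContMDiffAt ((𝓘(ℝ, E).prod 𝓘(ℝ, ℝ)).prod 𝓘(ℝ, E × EΘ)) 𝓘(ℝ, E) 1 (deviationField f θ)
      (n, basePoint E G EΘ θ) := by
  have hy : ContMDiffAt ((𝓘(ℝ, E).prod 𝓘(ℝ, ℝ)).prod 𝓘(ℝ, E × EΘ)) 𝓘(ℝ, E) 1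
      (fun z : (G × ℝ) × (E × EΘ) => z.2.1) (n, basePoint E G EΘ θ) :=
    contDiff_fst.contMDiff.contMDiffAt.comp _ contMDiffAt_snd
  have hL : ContMDiffAt ((𝓘(ℝ, E).prod 𝓘(ℝ, ℝ)).prod 𝓘(ℝ, E × EΘ)) 𝓘(ℝ, E →L[ℝ] E) 1
      (fun z : (G × ℝ) × (E × EΘ) => chartLeftMul E G z.2.1) (n, basePoint E G EΘ θ) :=
    ContMDiffAt.comp (n, basePoint E G EΘ θ) (g := chartLeftMul E G)
      contDiffAt_chartLeftMul.contMDiffAt hy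
  have hR : ContMDiffAt ((𝓘(ℝ, E).prod 𝓘(ℝ, ℝ)).prod 𝓘(ℝ, E × EΘ)) 𝓘(ℝ, E →L[ℝ] E) 1
      (fun z : (G × ℝ) × (E × EΘ) => chartRightMul E G z.2.1) (n, basePoint E G EΘ θ) :=
    ContMDiffAt.comp (n, basePoint E G EΘ θ) (g := chartRightMul E G)
      contDiffAt_chartRightMul.contMDiffAt hy
  have hv := contMDiffAt_localVelocity hf θ n
  have hv₀ : ContMDiffAt ((𝓘(ℝ, E).prod 𝓘(ℝ, ℝ)).prod 𝓘(ℝ, E × EΘ)) 𝓘(ℝ, E) 1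
      (fun z : (G × ℝ) × (E × EΘ) => localVelocity f θ (z.1, basePoint E G EΘ θ))
      (n, basePoint E G EΘ θ) :=
    ContMDiffAt.comp (n, basePoint E G EΘ θ) (g := localVelocity f θ)
      (f := fun z : (G × ℝ) × (E × EΘ) => (z.1, basePoint E G EΘ θ)) hv
      (contMDiffAt_fst.prodMk contMDiffAt_const)
  exact (hL.clm_apply hv).sub (hR.clm_apply hv₀)

variable [FiniteDimensional ℝ E]

include hf in
/-- The linearization of the velocity of the deviation is the derivative of the left-trivialized
vector field, corrected by the adjoint action of the velocity of the unperturbed trajectory. -/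
lemma fderiv_deviationField (θ : Θ) (n : G × ℝ) (A : E) (q : EΘ) :
    lieAd (leftTrivialize n.1 (f θ n.1 n.2)) A =
      (fderiv ℝ (fun x => localVelocity f θ (n, x)) (basePoint E G EΘ θ) (A, q) -
        fderiv ℝ (fun x => deviationField f θ (n, x)) (basePoint E G EΘ θ) (A, q) : E) := by
  set ξ : E := leftCoord n.1 (f θ n.1 n.2) with hξ
  have hv := (differentiableAt_partial (contMDiffAt_localVelocity hf θ n)).hasFDerivAt
  have hL : HasFDerivAt (chartLeftMul E G) (fderiv ℝ (chartLeftMul E G) (oneChart E G 1))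
      (oneChart E G 1) := (contDiffAt_chartLeftMul.differentiableAt one_ne_zero).hasFDerivAt
  have hR : HasFDerivAt (chartRightMul E G) (fderiv ℝ (chartRightMul E G) (oneChart E G 1))
      (oneChart E G 1) := (contDiffAt_chartRightMul.differentiableAt one_ne_zero).hasFDerivAt
  have hfst : HasFDerivAt (Prod.fst : E × EΘ → E) (.fst ℝ E EΘ) (basePoint E G EΘ θ) :=
    hasFDerivAt_fst
  have hL' := (HasFDerivAt.comp (f := Prod.fst) (basePoint E G EΘ θ) hL hfst).clm_apply hv
  have hR' := (HasFDerivAt.comp (f := Prod.fst) (basePoint E G EΘ θ) hR hfst).clm_apply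
    (hasFDerivAt_const ξ (basePoint E G EΘ θ))
  have hdev : HasFDerivAt (fun x => deviationField f θ (n, x)) _ (basePoint E G EΘ θ) :=
    (hL'.sub hR').congr_of_eventuallyEq (Eventually.of_forall fun x => by
      simp only [deviationField, localVelocity_basePoint]
      rfl)
  have happly : ∀ {m : E → E →L[ℝ] E}, HasFDerivAt m (fderiv ℝ m (oneChart E G 1))
      (oneChart E G 1) → ∀ B C : E, fderiv ℝ (fun y => m y B) (oneChart E G 1) C =
        fderiv ℝ m (oneChart E G 1) C B := fun hm B C => by
    have h := hm.clm_apply (hasFDerivAt_const B (oneChart E G 1))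
    rw [h.fderiv]
    simp
  have hbr : lieAd (leftTrivialize n.1 (f θ n.1 n.2)) A =
      (fderiv ℝ (chartLeftMul E G) (oneChart E G 1) ξ A -
        fderiv ℝ (chartLeftMul E G) (oneChart E G 1) A ξ : E) := by
    rw [← happly hL, ← happly hL]
    exact lie_eq_fderiv_chartLeftMul _ _
  have hRL : fderiv ℝ (chartRightMul E G) (oneChart E G 1) A ξ =
      fderiv ℝ (chartLeftMul E G) (oneChart E G 1) ξ A := by
    rw [← happly hR, ← happly hL]
    exact fderiv_chartRightMul_apply ξ A
  have h1 : chartLeftMul E G (basePoint E G EΘ θ).1 = .id ℝ E := chartLeftMul_one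
  rw [hdev.fderiv, hbr, ← hRL]
  simp [h1, localVelocity_basePoint, hξ]
  abel

end Regularity

end LocalCoordinates

/-! ### The adjoint equation in local coordinates -/

section AdjointState

open Filter Topology

variable {E : Type*} [NormedAddCommGroup E] [NormedSpace ℝ E]
  {G : Type*} [TopologicalSpace G] [ChartedSpace E G] [Group G] [LieGroup 𝓘(ℝ, E) ∞ G]
  {EΘ : Type*} [NormedAddCommGroup EΘ] [NormedSpace ℝ EΘ]
  {Θ : Type*} [TopologicalSpace Θ] [ChartedSpace EΘ Θ] [IsManifold 𝓘(ℝ, EΘ) ∞ Θ]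
  {f : Θ → (h : G) → ℝ → TangentSpace 𝓘(ℝ, E) h}
  (hf : ContMDiff (𝓘(ℝ, E).prod (𝓘(ℝ, EΘ).prod 𝓘(ℝ, ℝ))) 𝓘(ℝ, E).tangent 1
    (fun p : G × Θ × ℝ => (⟨p.1, f p.2.1 p.1 p.2.2⟩ : TangentBundle 𝓘(ℝ, E) G)))
  {r : G → Θ → ℝ → ℝ}
  (hr : ContMDiff (𝓘(ℝ, E).prod (𝓘(ℝ, EΘ).prod 𝓘(ℝ, ℝ))) 𝓘(ℝ, ℝ) 1
    (fun p : G × Θ × ℝ => r p.1 p.2.1 p.2.2))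

/-- The linearization of the velocity of the deviation at the unperturbed configuration. -/
def deviationLin (f : Θ → (h : G) → ℝ → TangentSpace 𝓘(ℝ, E) h) (θ : Θ) (n : G × ℝ) :
    E × EΘ →L[ℝ] E :=
  fderiv ℝ (fun x => deviationField f θ (n, x)) (basePoint E G EΘ θ)

variable (E EΘ) in
/-- The linearization of the running cost at the unperturbed configuration. -/
def costLin (r : G → Θ → ℝ → ℝ) (θ : Θ) (n : G × ℝ) : E × EΘ →L[ℝ] ℝ :=
  fderiv ℝ (fun x => localCost r θ (n, x)) (basePoint E G EΘ θ)

include hf hr in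
/-- The derivative of `(y, p) ↦ P (f̃) + r`, the control Hamiltonian with fixed momentum `P`. -/
lemma hasFDerivAt_hamiltonian (P : E →L[ℝ] ℝ) (θ : Θ) (n : G × ℝ) :
    HasFDerivAt (fun x : E × EΘ => P (localVelocity f θ (n, x)) + localCost r θ (n, x))
      (P.comp (fderiv ℝ (fun x => localVelocity f θ (n, x)) (basePoint E G EΘ θ)) +
        costLin E EΘ r θ n) (basePoint E G EΘ θ) := by
  have hv := (differentiableAt_partial (contMDiffAt_localVelocity hf θ n)).hasFDerivAt
  have hc := (differentiableAt_partial (contMDiffAt_localCost hr θ n)).hasFDerivAt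
  exact (P.hasFDerivAt.comp _ hv).add hc

variable [FiniteDimensional ℝ E]

include hf hr in
/-- The right-hand side of the adjoint equation is, up to sign, the transpose of the linearized
equation of motion of the deviation plus the derivative of the running cost. -/
lemma adjoint_rhs_eq (P : E →L[ℝ] ℝ) (θ : Θ) (n : G × ℝ) :
    (- leftGrad (fun h : G => (P : LieDual E G) (leftTrivialize h (f θ h n.2)) + r h θ n.2) n.1
      + lieAdDual (leftTrivialize n.1 (f θ n.1 n.2)) P : LieDual E G) =
    (-(P.comp ((deviationLin f θ n).comp (.inl ℝ E EΘ))) -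
      (costLin E EΘ r θ n).comp (.inl ℝ E EΘ) : E →L[ℝ] ℝ) := by
  set V : G → ℝ := fun h => P (leftCoord h (f θ h n.2)) + r h θ n.2 with hV
  have hVd : MDifferentiableAt 𝓘(ℝ, E) 𝓘(ℝ, ℝ) V n.1 := by
    have hi : ContMDiff 𝓘(ℝ, E) (𝓘(ℝ, E).prod (𝓘(ℝ, EΘ).prod 𝓘(ℝ, ℝ))) 1
        (fun h : G => (h, θ, n.2)) := contMDiff_id.prodMk (contMDiff_const.prodMk contMDiff_const)
    have h1 := (P.contDiff (n := 1)).contMDiff.comp ((contMDiff_leftCoord hf).comp hi)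
    exact (h1.add (hr.comp hi)).mdifferentiable one_ne_zero n.1
  have hgrad := hasFDerivAt_leftGrad hVd
  have hH := (hasFDerivAt_hamiltonian hf hr P θ n).comp (oneChart E G 1)
    (f := fun y => (y, extChartAt 𝓘(ℝ, EΘ) θ θ)) (hasFDerivAt_prodMk_left _ _)
  have heq : leftGradCoord V n.1 =
      (P.comp (fderiv ℝ (fun x => localVelocity f θ (n, x)) (basePoint E G EΘ θ)) +
        costLin E EΘ r θ n).comp (.inl ℝ E EΘ) := by
    refine hgrad.unique (hH.congr_of_eventuallyEq (Eventually.of_forall fun y => ?_))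
    simp only [hV, Function.comp_apply, localVelocity, localCost, nearPoint, extChartAt_to_inv]
  have hsum : ∀ K : E →L[ℝ] ℝ, (∀ A : E, K A =
        P (fderiv ℝ (fun x => localVelocity f θ (n, x)) (basePoint E G EΘ θ) (A, 0) -
          deviationLin f θ n (A, (0 : EΘ)))) →
      -leftGradCoord V n.1 + K =
        -(P.comp ((deviationLin f θ n).comp (.inl ℝ E EΘ))) -
          (costLin E EΘ r θ n).comp (.inl ℝ E EΘ) := by
    intro K hK
    rw [heq]
    refine ContinuousLinearMap.ext fun A => ?_
    simp only [add_apply, sub_apply, neg_apply, ContinuousLinearMap.comp_apply,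
      ContinuousLinearMap.inl_apply, hK, map_sub]
    ring
  exact hsum _ fun A => congrArg P (fderiv_deviationField hf θ n A 0)

include hf hr in
/-- The parameter derivative of the control Hamiltonian. -/
lemma paramGrad_controlHamiltonian (P : E →L[ℝ] ℝ) (θ : Θ) (n : G × ℝ) :
    paramGrad EΘ (fun η : Θ => controlHamiltonian f r n.1 P η n.2) θ =
      P.comp ((deviationLin f θ n).comp (.inr ℝ E EΘ)) +
        (costLin E EΘ r θ n).comp (.inr ℝ E EΘ) := by
  have hH := (hasFDerivAt_hamiltonian hf hr P θ n).comp (extChartAt 𝓘(ℝ, EΘ) θ θ)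
    (f := fun p => (oneChart E G 1, p)) (hasFDerivAt_prodMk_right _ _)
  have hcong : ∀ η : Θ, ∀ b : G, b = n.1 →
      P (leftCoord b (f η b n.2)) + r b η n.2 = controlHamiltonian f r n.1 P η n.2 := by
    rintro η _ rfl
    rfl
  have h1 := hasMFDerivAt_of_comp_extChartAt_symm
    (V := fun η : Θ => controlHamiltonian f r n.1 P η n.2) (x := θ)
    (hH.congr_of_eventuallyEq (Eventually.of_forall fun p => by
      simp only [Function.comp_apply, localVelocity, localCost, nearPoint]
      exact (hcong _ _ (by rw [oneChart_symm_oneChart_one, mul_one])).symm))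
  refine h1.mfderiv.trans ?_
  have hfin : (P.comp (fderiv ℝ (fun x => localVelocity f θ (n, x)) (basePoint E G EΘ θ)) +
        costLin E EΘ r θ n).comp (.inr ℝ E EΘ) =
      P.comp ((deviationLin f θ n).comp (.inr ℝ E EΘ)) +
        (costLin E EΘ r θ n).comp (.inr ℝ E EΘ) := by
    ext q
    have had := fderiv_deviationField hf θ n 0 q
    have h0 : lieAd (leftTrivialize n.1 (f θ n.1 n.2)) (0 : LieAlg E G) = (0 : E) := map_zero _
    have h2 := sub_eq_zero.1 (had.symm.trans h0)
    simp only [add_apply, ContinuousLinearMap.comp_apply, ContinuousLinearMap.inr_apply,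
      deviationLin, h2]
  exact hfin

end AdjointState

/-! ### Perturbed trajectories -/

section PerturbedTrajectories

open Filter Topology Metric

variable {E : Type*} [NormedAddCommGroup E] [NormedSpace ℝ E]
  {G : Type*} [TopologicalSpace G] [ChartedSpace E G]

lemma SolvesIVP.continuousOn {v : (h : G) → ℝ → TangentSpace 𝓘(ℝ, E) h} {T : ℝ} {g₀ : G}
    {g : ℝ → G} (h : SolvesIVP v T g₀ g) : ContinuousOn g (Icc 0 T) :=
  fun t ht => (h.2 t ht).1

variable [Group G] [LieGroup 𝓘(ℝ, E) ∞ G]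

/-- A finite-dimensional Lie group is a Hausdorff space: it is locally Euclidean, hence a `T₁`
space, and a topological group. -/
lemma t2Space_of_lieGroup (E : Type*) [NormedAddCommGroup E] [NormedSpace ℝ E]
    (G : Type*) [TopologicalSpace G] [ChartedSpace E G] [Group G] [LieGroup 𝓘(ℝ, E) ∞ G] :
    T2Space G := by
  have : IsTopologicalGroup G := topologicalGroup_of_lieGroup 𝓘(ℝ, E) ∞
  have : T1Space G := ChartedSpace.t1Space E G
  infer_instance

variable {EΘ : Type*} [NormedAddCommGroup EΘ] [NormedSpace ℝ EΘ]
  {Θ : Type*} [TopologicalSpace Θ] [ChartedSpace EΘ Θ] [IsManifold 𝓘(ℝ, EΘ) ∞ Θ]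
  {f : Θ → (h : G) → ℝ → TangentSpace 𝓘(ℝ, E) h}

/-- The coordinate of the deviation `g_θ(t)⁻¹ g_η(t)`, where `p` is the coordinate of `η`. -/
def deviation (g : Θ → ℝ → G) (θ : Θ) (p : EΘ) (t : ℝ) : E :=
  oneChart E G ((g θ t)⁻¹ * g ((extChartAt 𝓘(ℝ, EΘ) θ).symm p) t)

omit [LieGroup 𝓘(ℝ, E) ∞ G] [IsManifold 𝓘(ℝ, EΘ) ∞ Θ] in
/-- As long as the deviation stays in the domain of the chart, the perturbed trajectory can be
recovered from its coordinate. -/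
lemma nearPoint_deviation {g : Θ → ℝ → G} {θ : Θ} {p : EΘ} {t : ℝ}
    (h : (g θ t)⁻¹ * g ((extChartAt 𝓘(ℝ, EΘ) θ).symm p) t ∈ (oneChart E G).source) :
    nearPoint (E := E) θ ((g θ t, t), (deviation g θ p t, p)) =
      (g ((extChartAt 𝓘(ℝ, EΘ) θ).symm p) t, (extChartAt 𝓘(ℝ, EΘ) θ).symm p, t) := by
  rw [nearPoint, deviation]
  simp only
  rw [(oneChart E G).left_inv h, mul_inv_cancel_left]

omit [IsManifold 𝓘(ℝ, EΘ) ∞ Θ] in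
lemma hasDerivWithinAt_deviation_trajectory {T : ℝ} {g₀ : G} {g : Θ → ℝ → G}
    (hg : ∀ η, SolvesIVP (f η) T g₀ (g η)) {θ : Θ} {p : EΘ} {t : ℝ} (ht : t ∈ Icc 0 T)
    (h : (g θ t)⁻¹ * g ((extChartAt 𝓘(ℝ, EΘ) θ).symm p) t ∈ (oneChart E G).source) :
    HasDerivWithinAt (deviation g θ p)
      (deviationField f θ ((g θ t, t), (deviation g θ p t, p))) (Icc 0 T) t := by
  refine (hasDerivWithinAt_deviation ht ((hg θ).2 t ht)
    ((hg ((extChartAt 𝓘(ℝ, EΘ) θ).symm p)).2 t ht) h).congr_deriv ?_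
  have hvel : localVelocity f θ ((g θ t, t), (deviation g θ p t, p)) =
      leftCoord (g ((extChartAt 𝓘(ℝ, EΘ) θ).symm p) t)
        (f ((extChartAt 𝓘(ℝ, EΘ) θ).symm p) (g ((extChartAt 𝓘(ℝ, EΘ) θ).symm p) t) t) := by
    have : ∀ q : G × Θ × ℝ, q = (g ((extChartAt 𝓘(ℝ, EΘ) θ).symm p) t,
        (extChartAt 𝓘(ℝ, EΘ) θ).symm p, t) → leftCoord q.1 (f q.2.1 q.1 q.2.2) =
        leftCoord (g ((extChartAt 𝓘(ℝ, EΘ) θ).symm p) t)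
          (f ((extChartAt 𝓘(ℝ, EΘ) θ).symm p) (g ((extChartAt 𝓘(ℝ, EΘ) θ).symm p) t) t) := by
      rintro _ rfl
      rfl
    exact this _ (nearPoint_deviation h)
  rw [deviationField, hvel, localVelocity_basePoint]
  rfl

/-- For parameters near `θ`, the deviation stays in the domain of the chart throughout `[0, T]`
and is bounded by a multiple of the change of the parameter. -/
lemma exists_eventually_deviation_le [FiniteDimensional ℝ E]
    (hf : ContMDiff (𝓘(ℝ, E).prod (𝓘(ℝ, EΘ).prod 𝓘(ℝ, ℝ))) 𝓘(ℝ, E).tangent 1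
      (fun p : G × Θ × ℝ => (⟨p.1, f p.2.1 p.1 p.2.2⟩ : TangentBundle 𝓘(ℝ, E) G)))
    {T : ℝ} {g₀ : G} {g : Θ → ℝ → G} (hg : ∀ η, SolvesIVP (f η) T g₀ (g η)) (θ : Θ) :
    ∃ C : ℝ, ∀ᶠ p in 𝓝 (extChartAt 𝓘(ℝ, EΘ) θ θ), ∀ t ∈ Icc 0 T,
      (g θ t)⁻¹ * g ((extChartAt 𝓘(ℝ, EΘ) θ).symm p) t ∈ (oneChart E G).source ∧
      ‖deviation g θ p t - oneChart E G 1‖ ≤ C * ‖p - extChartAt 𝓘(ℝ, EΘ) θ θ‖ := by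
  have : IsTopologicalGroup G := topologicalGroup_of_lieGroup 𝓘(ℝ, E) ∞
  have : T2Space G := t2Space_of_lieGroup E G
  have : ProperSpace E := FiniteDimensional.proper_real E
  set y₀ := oneChart E G 1
  set p₀ := extChartAt 𝓘(ℝ, EΘ) θ θ
  set ψ := (extChartAt 𝓘(ℝ, EΘ) θ).symm
  have hσ : ContinuousOn (fun t => (g θ t, t)) (Icc 0 T) :=
    (hg θ).continuousOn.prodMk continuousOn_id
  have hloc := isLocallyUniformLinearization_of_contMDiffAt (x₀ := basePoint E G EΘ θ) hσ
    (fun t _ => contMDiffAt_deviationField hf θ (g θ t, t))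
  obtain ⟨δ, hδ, C, hC, hbound⟩ := exists_norm_sub_le_of_stationary
    (hloc.isUniformLinearization isCompact_Icc) hloc.continuousOn
    (fun t _ => deviationField_basePoint f θ _)
  obtain ⟨ρ, hρ, hρt⟩ := Metric.mem_nhds_iff.1
    (oneChart_target_mem_nhds (oneChart_one_mem_target (E := E) (G := G)))
  set ε := min δ ρ with hε
  have hε0 : 0 < ε := lt_min hδ hρ
  refine ⟨C, ?_⟩
  have hsmall : Tendsto (fun p => C * ‖p - p₀‖) (𝓝 p₀) (𝓝 0) := by
    have : Continuous fun p => C * ‖p - p₀‖ := by fun_prop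
    simpa using this.tendsto p₀
  filter_upwards [Metric.ball_mem_nhds p₀ hδ, hsmall.eventually (gt_mem_nhds (half_pos hε0))]
    with p hpδ hpε
  rw [mem_ball, dist_eq_norm] at hpδ
  set c : ℝ → G := fun t => (g θ t)⁻¹ * g (ψ p) t with hc
  have hcc : ContinuousOn c (Icc 0 T) := (hg θ).continuousOn.inv.mul (hg _).continuousOn
  have hc0 : c 0 = 1 := by simp only [hc, (hg _).1, inv_mul_cancel]
  -- Trapping: as long as the deviation stays in the neighbourhood `U` of the identity, Grönwall's
  -- inequality keeps it in the smaller compact, hence closed, set `K`.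
  set U : Set G := (oneChart E G).source ∩ oneChart E G ⁻¹' ball y₀ ε with hU
  set K : Set G := (oneChart E G).symm '' closedBall y₀ (ε / 2) with hK
  have hUo : IsOpen U := (continuousOn_extChartAt (I := 𝓘(ℝ, E)) (1 : G)).isOpen_inter_preimage
    (isOpen_extChartAt_source (1 : G)) isOpen_ball
  have hKt : closedBall y₀ (ε / 2) ⊆ (oneChart E G).target :=
    ((closedBall_subset_ball (half_lt_self hε0)).trans
      (ball_subset_ball (min_le_right δ ρ))).trans hρt
  have hKc : IsClosed K := ((isCompact_closedBall y₀ (ε / 2)).image_of_continuousOn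
    ((continuousOn_extChartAt_symm (1 : G)).mono hKt)).isClosed
  have hKU : K ⊆ U := by
    rintro _ ⟨y, hy, rfl⟩
    refine ⟨(oneChart E G).map_target (hKt hy), ?_⟩
    rw [mem_preimage, (oneChart E G).right_inv (hKt hy)]
    exact closedBall_subset_ball (half_lt_self hε0) hy
  have h0U : c 0 ∈ U := by
    rw [hc0]
    exact ⟨mem_extChartAt_source (1 : G), mem_ball_self hε0⟩
  have hest : ∀ t ∈ Icc 0 T, (∀ s ∈ Icc 0 t, c s ∈ U) →
      ‖deviation g θ p t - y₀‖ ≤ C * ‖p - p₀‖ := by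
    intro t ht hin
    have hsub : Icc 0 t ⊆ Icc 0 T := Icc_subset_Icc_right ht.2
    refine hbound p hpδ t ht.2 (deviation g θ p) ?_ (fun s hs => ?_) (fun s hs => ?_) t
      ⟨ht.1, le_rfl⟩
    · exact congrArg (oneChart E G) hc0
    · exact ((hasDerivWithinAt_deviation_trajectory hg (hsub hs)
        (hin s hs).1).continuousWithinAt).mono hsub
    · have hs' := Ico_subset_Icc_self hs
      refine ⟨?_, ?_⟩
      · have := (hin s hs').2
        rw [mem_preimage, mem_ball, dist_eq_norm] at this
        exact this.trans_le (min_le_left _ _)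
      · exact hasDerivWithinAt_Ici_of_Icc (b := T) ⟨hs.1, hs.2.trans_le ht.2⟩
          (hasDerivWithinAt_deviation_trajectory hg (hsub hs') (hin s hs').1)
  have htrap := forall_mem_of_forall_Ico_mem_closed hcc hUo hKc hKU h0U (by
    intro τ hτ hin t ht
    have ht' : t ∈ Icc 0 T := ⟨ht.1, ht.2.le.trans hτ.2⟩
    refine ⟨oneChart E G (c t), ?_, (oneChart E G).left_inv (hin t ht).1⟩
    rw [mem_closedBall, dist_eq_norm]
    exact (hest t ht' fun s hs => hin s ⟨hs.1, hs.2.trans_lt ht.2⟩).trans hpε.le)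
  exact fun t ht => ⟨(htrap t ht).1, hest t ht fun s hs => htrap s ⟨hs.1, hs.2.trans ht.2⟩⟩

/-- The terminal cost near `(a, θ)` in coordinates: its derivative at the unperturbed configuration
combines the left-trivialized gradient in the group and the partial differential in the
parameter. -/
lemma exists_hasFDerivAt_terminalCost {F : G → Θ → ℝ}
    (hF : MDifferentiable (𝓘(ℝ, E).prod 𝓘(ℝ, EΘ)) 𝓘(ℝ, ℝ) (fun p : G × Θ => F p.1 p.2))
    (θ : Θ) (a : G) :
    ∃ Φ' : E × EΘ →L[ℝ] ℝ,
      HasFDerivAt (fun x : E × EΘ =>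
        F (a * (oneChart E G).symm x.1) ((extChartAt 𝓘(ℝ, EΘ) θ).symm x.2)) Φ'
        (basePoint E G EΘ θ) ∧
      Φ'.comp (.inl ℝ E EΘ) = leftGradCoord (fun h : G => F h θ) a ∧
      Φ'.comp (.inr ℝ E EΘ) = paramGrad EΘ (fun η : Θ => F a η) θ := by
  set Φ : E × EΘ → ℝ := fun x =>
    F (a * (oneChart E G).symm x.1) ((extChartAt 𝓘(ℝ, EΘ) θ).symm x.2) with hΦ
  have hi : ContMDiffAt 𝓘(ℝ, E × EΘ) (𝓘(ℝ, E).prod (𝓘(ℝ, EΘ).prod 𝓘(ℝ, ℝ))) 1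
      (fun x => nearPoint (E := E) θ (((a, 0) : G × ℝ), x)) (basePoint E G EΘ θ) :=
    ContMDiffAt.comp (basePoint E G EΘ θ) (g := nearPoint θ)
      (f := fun x => (((a, 0) : G × ℝ), x)) (contMDiffAt_nearPoint θ (a, 0))
      (contMDiffAt_const.prodMk contMDiffAt_id)
  have hi' : ContMDiffAt 𝓘(ℝ, E × EΘ) (𝓘(ℝ, E).prod 𝓘(ℝ, EΘ)) 1
      (fun x : E × EΘ => (a * (oneChart E G).symm x.1, (extChartAt 𝓘(ℝ, EΘ) θ).symm x.2))
      (basePoint E G EΘ θ) :=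
    (contMDiffAt_fst.comp _ hi).prodMk (contMDiffAt_fst.comp _ (contMDiffAt_snd.comp _ hi))
  have hd : DifferentiableAt ℝ Φ (basePoint E G EΘ θ) := by
    have := MDifferentiableAt.comp (basePoint E G EΘ θ) (g := fun p : G × Θ => F p.1 p.2)
      (hF _) (hi'.mdifferentiableAt one_ne_zero)
    exact mdifferentiableAt_iff_differentiableAt.1 this
  refine ⟨fderiv ℝ Φ (basePoint E G EΘ θ), hd.hasFDerivAt, ?_, ?_⟩
  · have hm : MDifferentiableAt 𝓘(ℝ, E) 𝓘(ℝ, ℝ) (fun h : G => F h θ) a :=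
      MDifferentiableAt.comp a (g := fun p : G × Θ => F p.1 p.2) (f := fun h => (h, θ)) (hF _)
        (mdifferentiableAt_id.prodMk mdifferentiableAt_const)
    have h1 := hd.hasFDerivAt.comp (oneChart E G 1)
      (f := fun y => (y, extChartAt 𝓘(ℝ, EΘ) θ θ)) (hasFDerivAt_prodMk_left _ _)
    refine h1.unique ((hasFDerivAt_leftGrad hm).congr_of_eventuallyEq
      (Filter.Eventually.of_forall fun y => ?_))
    simp only [hΦ, Function.comp_apply, extChartAt_to_inv]
  · have h1 := hd.hasFDerivAt.comp (extChartAt 𝓘(ℝ, EΘ) θ θ)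
      (f := fun p => (oneChart E G 1, p)) (hasFDerivAt_prodMk_right _ _)
    refine (hasMFDerivAt_of_comp_extChartAt_symm (V := fun η : Θ => F a η) (x := θ)
      (h1.congr_of_eventuallyEq (Filter.Eventually.of_forall fun p => ?_))).mfderiv.symm
    simp only [hΦ, Function.comp_apply, oneChart_symm_oneChart_one, mul_one]

end PerturbedTrajectories

end LieAdjoint

end

theorem mainTheorem3
    {E : Type*} [NormedAddCommGroup E] [NormedSpace ℝ E] [FiniteDimensional ℝ E]
    {G : Type*} [TopologicalSpace G] [ChartedSpace E G] [Group G] [LieGroup 𝓘(ℝ, E) ∞ G]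
    {EΘ : Type*} [NormedAddCommGroup EΘ] [NormedSpace ℝ EΘ] [FiniteDimensional ℝ EΘ]
    {Θ : Type*} [TopologicalSpace Θ] [ChartedSpace EΘ Θ] [IsManifold 𝓘(ℝ, EΘ) ∞ Θ]
    (f : Θ → (h : G) → ℝ → TangentSpace 𝓘(ℝ, E) h)
    (hf : ContMDiff (𝓘(ℝ, E).prod (𝓘(ℝ, EΘ).prod 𝓘(ℝ, ℝ))) 𝓘(ℝ, E).tangent 1
      (fun p : G × Θ × ℝ => (⟨p.1, f p.2.1 p.1 p.2.2⟩ : TangentBundle 𝓘(ℝ, E) G)))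
    (r : G → Θ → ℝ → ℝ)
    (hr : ContMDiff (𝓘(ℝ, E).prod (𝓘(ℝ, EΘ).prod 𝓘(ℝ, ℝ))) 𝓘(ℝ, ℝ) 1
      (fun p : G × Θ × ℝ => r p.1 p.2.1 p.2.2))
    (F : G → Θ → ℝ)
    (hF : MDifferentiable (𝓘(ℝ, E).prod 𝓘(ℝ, EΘ)) 𝓘(ℝ, ℝ) (fun p : G × Θ => F p.1 p.2))
    (T : ℝ) (hT : 0 ≤ T) (g₀ : G) (g : Θ → ℝ → G)
    (hg : ∀ θ, LieAdjoint.SolvesIVP (f θ) T g₀ (g θ)) (θ : Θ) :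
    ∃ P : ℝ → LieAdjoint.LieDual E G,
      LieAdjoint.IsAdjointState f r F T θ (g θ) P ∧
      (∀ Q : ℝ → LieAdjoint.LieDual E G,
        LieAdjoint.IsAdjointState f r F T θ (g θ) Q → EqOn Q P (Icc 0 T)) ∧
      LieAdjoint.SolvesLieHamilton
        (fun t h Q => LieAdjoint.controlHamiltonian f r h Q θ t) (g θ) P (Icc 0 T) ∧
      MDifferentiableAt 𝓘(ℝ, EΘ) 𝓘(ℝ, ℝ) (LieAdjoint.trajectoryCost r F T g) θ ∧
      IntervalIntegrable
        (fun t => LieAdjoint.paramGrad EΘ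
          (fun η : Θ => LieAdjoint.controlHamiltonian f r (g θ t) (P t) η t) θ)
        MeasureTheory.volume 0 T ∧
      LieAdjoint.paramGrad EΘ (LieAdjoint.trajectoryCost r F T g) θ =
        LieAdjoint.paramGrad EΘ (fun η : Θ => F (g θ T) η) θ +
          ∫ t in (0 : ℝ)..T, LieAdjoint.paramGrad EΘ
            (fun η : Θ => LieAdjoint.controlHamiltonian f r (g θ t) (P t) η t) θ := by
  open Filter Topology LieAdjoint in
  set σ : ℝ → G × ℝ := fun t => (g θ t, t) with hσdef
  have hσ : ContinuousOn σ (Icc 0 T) := (hg θ).continuousOn.prodMk continuousOn_id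
  set x₀ : E × EΘ := basePoint E G EΘ θ with hx₀
  set D : ℝ → E × EΘ →L[ℝ] E := fun t => deviationLin f θ (σ t) with hD
  set R : ℝ → E × EΘ →L[ℝ] ℝ := fun t => costLin E EΘ r θ (σ t) with hR
  have hv := isLocallyUniformLinearization_of_contMDiffAt (x₀ := x₀) hσ
    (fun t _ => contMDiffAt_deviationField hf θ (σ t))
  have hρ := isLocallyUniformLinearization_of_contMDiffAt (x₀ := x₀) hσ
    (fun t _ => contMDiffAt_localCost hr θ (σ t))
  have hDc : ContinuousOn D (Icc 0 T) := hv.continuousOn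
  have hRc : ContinuousOn R (Icc 0 T) := hρ.continuousOn
  -- The adjoint equation in the form `P' = L P + b`.
  set L : ℝ → (E →L[ℝ] ℝ) →L[ℝ] (E →L[ℝ] ℝ) := fun t =>
    -(ContinuousLinearMap.compL ℝ E E ℝ).flip ((D t).comp (.inl ℝ E EΘ)) with hL
  set b : ℝ → E →L[ℝ] ℝ := fun t => -(R t).comp (.inl ℝ E EΘ) with hb
  have hLc : ContinuousOn L (Icc 0 T) :=
    ((ContinuousLinearMap.compL ℝ E E ℝ).flip.continuous.comp_continuousOn
      (hDc.clm_comp continuousOn_const)).neg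
  have hbc : ContinuousOn b (Icc 0 T) := (hRc.clm_comp continuousOn_const).neg
  set P₁ : E →L[ℝ] ℝ := leftGradCoord (fun h : G => F h θ) (g θ T) with hP₁
  have hrhs : ∀ (Q : E →L[ℝ] ℝ) (t : ℝ),
      (- leftGrad (fun h : G => (Q : LieDual E G) (leftTrivialize h (f θ h t)) + r h θ t) (g θ t)
        + lieAdDual (leftTrivialize (g θ t) (f θ (g θ t) t)) Q : LieDual E G) =
      (L t Q + b t : E →L[ℝ] ℝ) := fun Q t => by
    refine (adjoint_rhs_eq hf hr Q θ (σ t)).trans ?_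
    have : -(Q.comp ((D t).comp (.inl ℝ E EΘ))) - (R t).comp (.inl ℝ E EΘ) = L t Q + b t := by
      rw [sub_eq_add_neg]
      rfl
    exact this
  have hiff : ∀ Q : ℝ → E →L[ℝ] ℝ, IsAdjointState f r F T θ (g θ) Q ↔
      (∀ t ∈ Icc 0 T, HasDerivWithinAt Q (L t (Q t) + b t) (Icc 0 T) t) ∧ Q T = P₁ := by
    intro Q
    have h1 : ∀ t, HasDerivWithinAt (F := LieDual E G) Q
        (- leftGrad (fun h : G => (Q t : LieDual E G) (leftTrivialize h (f θ h t)) + r h θ t) (g θ t)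
        + lieAdDual (leftTrivialize (g θ t) (f θ (g θ t) t)) (Q t)) (Icc 0 T) t ↔
        HasDerivWithinAt Q (L t (Q t) + b t) (Icc 0 T) t := fun t => by
      rw [hrhs (Q t) t]
      exact Iff.rfl
    exact and_congr (forall₂_congr fun t _ => h1 t) Iff.rfl
  -- `IsAdjointState` is now a linear terminal value problem in the normed space `E →L[ℝ] ℝ`.
  obtain ⟨P, hPT, hP⟩ := exists_solution_linear hT hLc hbc P₁
  have hPadj : IsAdjointState f r F T θ (g θ) P := (hiff P).2 ⟨hP, hPT⟩
  refine ⟨P, hPadj, fun Q hQ => ?_, fun t ht => ?_, ?_⟩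
  · exact eqOn_of_solution_linear hLc ((hiff Q).1 hQ).1 hP (((hiff Q).1 hQ).2.trans hPT.symm)
  · refine ⟨leftTrivialize (g θ t) (f θ (g θ t) t), ?_, ?_, hPadj.1 t ht⟩
    · exact (ContinuousLinearMap.apply ℝ ℝ (leftCoord (g θ t) (f θ (g θ t) t)) :
        (E →L[ℝ] ℝ) →L[ℝ] ℝ).hasFDerivAt.add_const _
    · rw [mulInvariantVectorField_leftTrivialize]
      exact (hg θ).2 t ht
  have hPc : ContinuousOn P (Icc 0 T) := fun t ht => (hP t ht).continuousWithinAt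
  set S : ℝ → EΘ →L[ℝ] ℝ := fun t =>
    (P t).comp ((D t).comp (.inr ℝ E EΘ)) + (R t).comp (.inr ℝ E EΘ) with hS
  have hgrad : ∀ t, paramGrad EΘ
      (fun η : Θ => controlHamiltonian f r (g θ t) (P t) η t) θ = S t := fun t =>
    paramGrad_controlHamiltonian hf hr (P t) θ (σ t)
  have hSc : ContinuousOn S (Icc 0 T) :=
    (hPc.clm_comp (hDc.clm_comp continuousOn_const)).add (hRc.clm_comp continuousOn_const)
  -- The cost as a function of the coordinate of the parameter, through the deviation from `g θ`.
  obtain ⟨Φ', hΦ, hΦl, hΦr⟩ := exists_hasFDerivAt_terminalCost hF θ (g θ T)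
  obtain ⟨C, hC⟩ := exists_eventually_deviation_le hf hg θ
  have hcost : ∀ {p : EΘ} {t : ℝ},
      (g θ t)⁻¹ * g ((extChartAt 𝓘(ℝ, EΘ) θ).symm p) t ∈ (oneChart E G).source →
      localCost r θ (σ t, (deviation g θ p t, p)) =
        r (g ((extChartAt 𝓘(ℝ, EΘ) θ).symm p) t) ((extChartAt 𝓘(ℝ, EΘ) θ).symm p) t :=
    fun {p t} h => congrArg (fun q : G × Θ × ℝ => r q.1 q.2.1 q.2.2) (nearPoint_deviation h)
  have hmain := hasFDerivAt_cost_of_adjoint hT (hv.isUniformLinearization isCompact_Icc) hDc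
    (fun t _ => deviationField_basePoint f θ (σ t)) (hρ.isUniformLinearization isCompact_Icc) hRc
    (l := P) (fun t ht => (hP t ht).congr_deriv (sub_eq_add_neg _ _).symm) hΦ
    (hPT.trans hΦl.symm) (z := deviation g θ)
    (Eventually.of_forall fun p => by
      rw [deviation, (hg θ).1, (hg _).1, inv_mul_cancel])
    (hC.mono fun p hp t ht => hasDerivWithinAt_deviation_trajectory hg ht (hp t ht).1)
    (hC.mono fun p hp t ht => (hp t ht).2)
    (hC.mono fun p hp => by
      have hr' : ContinuousOn (fun t => r (g ((extChartAt 𝓘(ℝ, EΘ) θ).symm p) t)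
          ((extChartAt 𝓘(ℝ, EΘ) θ).symm p) t) (Icc 0 T) :=
        hr.continuous.comp_continuousOn
          ((hg _).continuousOn.prodMk (continuousOn_const.prodMk continuousOn_id))
      exact hr'.congr fun t ht => hcost (hp t ht).1)
  have hderiv := hasMFDerivAt_of_comp_extChartAt_symm (V := trajectoryCost r F T g) (x := θ)
    (hmain.congr_of_eventuallyEq (hC.mono fun p hp => by
      have hint : (∫ t in (0 : ℝ)..T, localCost r θ (σ t, (deviation g θ p t, p))) =
          ∫ t in (0 : ℝ)..T, r (g ((extChartAt 𝓘(ℝ, EΘ) θ).symm p) t)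
            ((extChartAt 𝓘(ℝ, EΘ) θ).symm p) t :=
        intervalIntegral.integral_congr fun t ht => hcost (hp t (uIcc_of_le hT ▸ ht)).1
      have hT' := (hp T ⟨hT, le_rfl⟩).1
      simp only [trajectoryCost, hint]
      rw [deviation, (oneChart E G).left_inv hT', mul_inv_cancel_left]))
  refine ⟨hderiv.mdifferentiableAt, ?_, ?_⟩
  · simp only [hgrad]
    exact ContinuousOn.intervalIntegrable (by rwa [uIcc_of_le hT])
  · simp only [hgrad]
    rw [← hΦr]
    exact hderiv.mfderiv
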